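/- **Model.** Let $\lambda,R,\beta>0$, $\alpha>2$, $\sigma^2\ge 0$, and let $\mathcal C\subset\mathbb R^2$ be the disk of radius $R$ centred at the origin (the base station). The D2D transmitters $x_1,x_2,\dots$ form a homogeneous Poisson point process $\Phi$ of density $\lambda$ on $\mathbb R^2$. The receiver $y_k$ of transmitter $x_k$ lies at distance $d_{k,k}>0$ from $x_k$ in a uniformly distributed direction. Transmitter $k$ uses power $p_k\ge 0$. An uplink user, uniformly distributed in $\mathcal C$, uses power $p_0\ge0$, and $d_{k,0}$ denotes its distance to $y_k$. The lengths $d_{k,k}$ are i.i.d. with distribution function $F_{d_{k,k}}$ (a fixed length being a special case), the powers $p_k$ ($k\ge1$) are i.i.d. with distribution function $F_{p_k}$ and $\mathbb E[p_k^{2/\alpha}]<\infty$, and the fading coefficients $h_{k,\ell}$ ($\ell\ge1$) and $h_{k,0}$ are i.i.d. $\mathcal{CN}(0,1)$. The process $\Phi$, the lengths, the directions, the D2D powers, the uplink user's location, $p_0$ and the fading coefficients are all independent. The SINR of link $k$ is $$\mathrm{SINR}_k=\frac{p_k|h_{k,k}|^2d_{k,k}^{-\alpha}}{\sum_{i\ne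 k}p_i|h_{k,i}|^2\|x_i-y_k\|^{-\alpha}+p_0|h_{k,0}|^2d_{k,0}^{-\alpha}+\sigma^2},$$ where a positive signal divided by $0$ counts as $\infty$ and a zero signal gives SINR $0$. The *typical D2D link* is the link of a typical receiver in $\mathcal C$, in the Palm sense: for a nonnegative functional $F_k$ of the link $k$ and the network, $$\mathbb E^{\mathrm{typ}}[F]=\frac{1}{\lambda\pi R^2}\,\mathbb E\Big[\sum_{k:\,y_k\in\mathcal C}F_k\Big],\qquad \mathbb P^{\mathrm{typ}}(A)=\mathbb E^{\mathrm{typ}}[\mathbf 1_A].$$ **Theorem.** $\mathbb P^{\mathrm{typ}}$ is a probability law, and the coverage probability $\bar P^{(D)}_{\rm cov}(\beta)=\mathbb P^{\mathrm{typ}}(\mathrm{SINR}_k\ge\beta)$ of the typical D2D link is $$\bar P^{(D)}_{\rm cov}(\beta)=\mathbb E^{\rm typ}\Big[e^{-b_1Z-b_2Z^{2/\alpha}}\,\mathcal L_Y(\beta Z)\Big],$$ where $b_1=\sigma^2\beta$, $b_2=\dfrac{\pi\lambda\beta^{2/\alpha}}{\operatorname{sinc}(2/\alpha)}\,\mathbb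 E[p_k^{2/\alpha}]$ with $\operatorname{sinc}(x)=\frac{\sin\pi x}{\pi x}$, $Z=p_k^{-1}d_{k,k}^{\alpha}$ (with $Z=\infty$ if $p_k=0$, in which case the expression in brackets is read as $0$), $Y=p_0|h_{k,0}|^2d_{k,0}^{-\alpha}$ and $\mathcal L_Y(s)=\mathbb E^{\rm typ}[e^{-sY}]$. Moreover $Z$ has the distribution function $$F_Z(z)=\mathbb P^{\rm typ}(Z\le z)=\int F_{d_{k,k}}\big(z^{1/\alpha}p^{1/\alpha}\big)\,dF_{p_k}(p),\qquad z\ge0.$$ -/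

import Mathlib

open MeasureTheory ProbabilityTheory
open scoped ENNReal NNReal

noncomputable section

namespace D2D

/-- The Euclidean plane. -/
abbrev Plane : Type := EuclideanSpace ℝ (Fin 2)

/-- The number of indices `i` for which the point `X i ω` lies in `B`. -/
def count {Ω : Type*} (X : ℕ → Ω → Plane) (B : Set Plane) (ω : Ω) : ℕ∞ :=
  {i : ℕ | X i ω ∈ B}.encard

/-- The random points `X 0, X 1, …` enumerate a homogeneous Poisson point process of density
`lam` on the plane: the number of points in a Borel set `B` of finite area is Poisson distributed
with mean `lam * area B`, and the numbers of points in disjoint sets are independent. (For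
`lam > 0` the process has infinitely many points, so that an enumeration by `ℕ` is no loss.) -/
structure IsHomogeneousPoissonProcess {Ω : Type*} [MeasurableSpace Ω] (P : Measure Ω)
    (lam : ℝ) (X : ℕ → Ω → Plane) : Prop where
  measurable : ∀ i, Measurable (X i)
  poisson : ∀ B : Set Plane, MeasurableSet B → volume B ≠ ∞ → ∀ n : ℕ,
    P {ω | count X B ω = n} =
      poissonMeasure (ENNReal.ofReal lam * volume B).toNNReal {n}
  indep : ∀ (m : ℕ) (B : Fin m → Set Plane), (∀ j, MeasurableSet (B j)) →
    (∀ j, volume (B j) ≠ ∞) → Pairwise (fun i j => Disjoint (B i) (B j)) →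
    iIndepFun (fun j => count X (B j)) P

/-- The circularly symmetric complex Gaussian law `𝒞𝒩(0, 1)`: the real and the imaginary part are
independent centered Gaussians of variance `1/2`. -/
def complexGaussian : Measure ℂ :=
  ((gaussianReal 0 (1 / 2)).prod (gaussianReal 0 (1 / 2))).map fun x => (⟨x.1, x.2⟩ : ℂ)

/-- The random quantities of a cellular network with one uplink user and D2D links `k : ℕ`. -/
structure Network (Ω : Type*) where
  /-- location of the transmitter of D2D link `k` -/
  tx : ℕ → Ω → Plane
  /-- distance between transmitter and receiver of link `k` -/
  d : ℕ → Ω → ℝ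
  /-- direction (angle) in which receiver `k` is seen from transmitter `k` -/
  dir : ℕ → Ω → ℝ
  /-- transmit power of D2D transmitter `k` -/
  p : ℕ → Ω → ℝ
  /-- location of the uplink user -/
  ue : Ω → Plane
  /-- transmit power of the uplink user -/
  p₀ : Ω → ℝ
  /-- `h k l` is the fading from D2D transmitter `l` to D2D receiver `k` -/
  h : ℕ → ℕ → Ω → ℂ
  /-- `h₀ k` is the fading from the uplink user to D2D receiver `k` -/
  h₀ : ℕ → Ω → ℂ

/-- Labels of the independent sources of randomness. -/
inductive Source : Type
  | tx : Source
  | ue : Source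
  | p₀ : Source
  | d (k : ℕ) : Source
  | dir (k : ℕ) : Source
  | p (k : ℕ) : Source
  | h (k l : ℕ) : Source
  | h₀ (k : ℕ) : Source

namespace Network

variable {Ω : Type*}

/-- The σ-algebra generated by each source of randomness; the whole sequence of transmitter
locations is one source. -/
@[reducible] def sigma (N : Network Ω) : Source → MeasurableSpace Ω
  | .tx => MeasurableSpace.comap (fun ω i => N.tx i ω) inferInstance
  | .ue => MeasurableSpace.comap N.ue inferInstance
  | .p₀ => MeasurableSpace.comap N.p₀ inferInstance
  | .d k => MeasurableSpace.comap (N.d k) inferInstance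
  | .dir k => MeasurableSpace.comap (N.dir k) inferInstance
  | .p k => MeasurableSpace.comap (N.p k) inferInstance
  | .h k l => MeasurableSpace.comap (N.h k l) inferInstance
  | .h₀ k => MeasurableSpace.comap (N.h₀ k) inferInstance

/-- The system model. The cell is the disk of radius `R` about the base station, which is at the
origin; D2D transmitters form a Poisson process of density `lam`; `Fp`, `Fp₀`, `Fd` are the laws
of the D2D transmit powers, of the uplink transmit power and of the D2D link lengths. -/
structure IsModel [MeasurableSpace Ω] (N : Network Ω) (P : Measure Ω) (lam R : ℝ)
    (Fp Fp₀ Fd : Measure ℝ) : Prop where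
  poisson : IsHomogeneousPoissonProcess P lam N.tx
  measurable_d : ∀ k, Measurable (N.d k)
  measurable_dir : ∀ k, Measurable (N.dir k)
  measurable_p : ∀ k, Measurable (N.p k)
  measurable_ue : Measurable N.ue
  measurable_p₀ : Measurable N.p₀
  measurable_h : ∀ k l, Measurable (N.h k l)
  measurable_h₀ : ∀ k, Measurable (N.h₀ k)
  law_d : ∀ k, P.map (N.d k) = Fd
  law_dir : ∀ k, pdf.IsUniform (N.dir k) (Set.Ico 0 (2 * Real.pi)) P volume
  law_p : ∀ k, P.map (N.p k) = Fp
  law_ue : pdf.IsUniform N.ue (Metric.closedBall 0 R) P volume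
  law_p₀ : P.map N.p₀ = Fp₀
  law_h : ∀ k l, P.map (N.h k l) = complexGaussian
  law_h₀ : ∀ k, P.map (N.h₀ k) = complexGaussian
  indep : iIndep N.sigma P

/-- Location of the receiver of D2D link `k`. -/
def rx (N : Network Ω) (k : ℕ) (ω : Ω) : Plane :=
  N.tx k ω + N.d k ω • !₂[Real.cos (N.dir k ω), Real.sin (N.dir k ω)]

/-- Power `q |g|² r^(-α)` received at distance `r` with transmit power `q` and fading `g`. -/
def rxPower (α q : ℝ) (g : ℂ) (r : ℝ) : ℝ≥0∞ :=
  ENNReal.ofReal q * ENNReal.ofReal (‖g‖ ^ 2) * ENNReal.ofReal r ^ (-α)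

/-- Useful power at receiver `k`. -/
def signal (N : Network Ω) (α : ℝ) (k : ℕ) (ω : Ω) : ℝ≥0∞ :=
  rxPower α (N.p k ω) (N.h k k ω) (N.d k ω)

/-- Interference at receiver `k` from all the other D2D transmitters. -/
def d2dInterference (N : Network Ω) (α : ℝ) (k : ℕ) (ω : Ω) : ℝ≥0∞ :=
  ∑' l : {l : ℕ // l ≠ k}, rxPower α (N.p l ω) (N.h k l ω) (dist (N.tx l ω) (N.rx k ω))

/-- `Y`: interference at receiver `k` from the uplink user. -/
def cellInterference (N : Network Ω) (α : ℝ) (k : ℕ) (ω : Ω) : ℝ≥0∞ :=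
  rxPower α (N.p₀ ω) (N.h₀ k ω) (dist (N.ue ω) (N.rx k ω))

/-- SINR of link `k`, with noise power `σ2`; a positive signal without noise and interference has
SINR `∞`, and a zero signal has SINR `0`. -/
def sinr (N : Network Ω) (α σ2 : ℝ) (k : ℕ) (ω : Ω) : ℝ≥0∞ :=
  N.signal α k ω / (N.d2dInterference α k ω + N.cellInterference α k ω + ENNReal.ofReal σ2)

/-- `Z = p⁻¹ d^α` for link `k`, which is `∞` if the transmitter is silent (`p = 0`). -/
def Z (N : Network Ω) (α : ℝ) (k : ℕ) (ω : Ω) : ℝ≥0∞ :=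
  (ENNReal.ofReal (N.p k ω))⁻¹ * ENNReal.ofReal (N.d k ω) ^ α

/-- The Palm law of the typical D2D link, i.e. of a link whose receiver is in the cell, on pairs
`(k, ω)` of a link and a realization of the network: the expectation of `F` under this law is
`E[∑_{k : rx k ∈ C} F k] / (lam * area C)`, where `C` is the disk of radius `R`. -/
def typicalLink [MeasurableSpace Ω] (N : Network Ω) (P : Measure Ω) (lam R : ℝ) :
    Measure (ℕ × Ω) :=
  (ENNReal.ofReal lam * volume (Metric.closedBall (0 : Plane) R))⁻¹ •
    Measure.sum fun k =>
      (P.restrict {ω | N.rx k ω ∈ Metric.closedBall (0 : Plane) R}).map (Prod.mk k)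

/-- Coverage probability of the typical D2D link: the probability that its SINR is at least `β`. -/
def coverage [MeasurableSpace Ω] (N : Network Ω) (P : Measure Ω) (lam R α σ2 β : ℝ) : ℝ :=
  (N.typicalLink P lam R).real {x | ENNReal.ofReal β ≤ N.sinr α σ2 x.1 x.2}

/-- Laplace transform of the cellular interference `Y` at the receiver of the typical D2D link
(`Y` is almost surely finite). -/
def laplaceY [MeasurableSpace Ω] (N : Network Ω) (P : Measure Ω) (lam R α s : ℝ) : ℝ :=
  ∫ x, Real.exp (-s * (N.cellInterference α x.1 x.2).toReal) ∂(N.typicalLink P lam R)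

end Network

/-- The normalized cardinal sine `sin (π x) / (π x)`. -/
def nsinc (x : ℝ) : ℝ := Real.sinc (Real.pi * x)

/-- The function `z ↦ exp(-b₁ z - b₂ z^(2/α)) L(β z)` on `[0, ∞]`, with value `0` at `∞`. -/
def coverageKernel (α β b₁ b₂ : ℝ) (L : ℝ → ℝ) (z : ℝ≥0∞) : ℝ :=
  if z = ∞ then 0
  else Real.exp (-b₁ * z.toReal - b₂ * z.toReal ^ (2 / α)) * L (β * z.toReal)

end D2D

end

open Filter
open scoped Topology

noncomputable section

namespace D2D

/-- The decreasing exponential `x ↦ exp (-x)` on `[0, ∞]`, with value `0` at `∞`. -/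
def nexp (x : ℝ≥0∞) : ℝ≥0∞ := EReal.exp (-(x : EReal))

/-- The inverse `y ↦ -log y` of `nexp` on `[0, 1]`. -/
def nlog (y : ℝ≥0∞) : ℝ≥0∞ := (-(ENNReal.log y)).toENNReal

@[simp] lemma nexp_zero : nexp 0 = 1 := by simp [nexp]

@[simp] lemma nexp_top : nexp ∞ = 0 := by simp [nexp]

lemma nexp_ofReal {x : ℝ} (hx : 0 ≤ x) :
    nexp (ENNReal.ofReal x) = ENNReal.ofReal (Real.exp (-x)) := by
  rw [nexp, EReal.coe_ennreal_ofReal, max_eq_left hx, ← EReal.coe_neg, EReal.exp_coe]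

lemma nexp_of_ne_top {x : ℝ≥0∞} (hx : x ≠ ∞) :
    nexp x = ENNReal.ofReal (Real.exp (-x.toReal)) := by
  rw [← nexp_ofReal ENNReal.toReal_nonneg, ENNReal.ofReal_toReal hx]

lemma continuous_nexp : Continuous nexp :=
  ENNReal.continuous_exp.comp (continuous_neg.comp continuous_coe_ennreal_ereal)

@[fun_prop]
lemma measurable_nexp : Measurable nexp := continuous_nexp.measurable

lemma antitone_nexp : Antitone nexp := fun _ _ h =>
  EReal.exp_monotone (EReal.neg_le_neg_iff.2 (EReal.coe_ennreal_le_coe_ennreal_iff.2 h))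

lemma nexp_le_one (x : ℝ≥0∞) : nexp x ≤ 1 := nexp_zero ▸ antitone_nexp zero_le

lemma nexp_ne_top (x : ℝ≥0∞) : nexp x ≠ ∞ := ((nexp_le_one x).trans_lt ENNReal.one_lt_top).ne

lemma nexp_add (x y : ℝ≥0∞) : nexp (x + y) = nexp x * nexp y := by
  rcases eq_or_ne x ∞ with rfl | hx
  · simp
  rcases eq_or_ne y ∞ with rfl | hy
  · simp
  rw [nexp_of_ne_top hx, nexp_of_ne_top hy, nexp_of_ne_top (by simp [hx, hy]),
    ENNReal.toReal_add hx hy, neg_add, Real.exp_add, ENNReal.ofReal_mul (Real.exp_nonneg _)]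

lemma nexp_sum {ι : Type*} (s : Finset ι) (f : ι → ℝ≥0∞) :
    nexp (∑ i ∈ s, f i) = ∏ i ∈ s, nexp (f i) := by
  classical
  induction s using Finset.induction_on with
  | empty => simp
  | insert a s ha ih => rw [Finset.sum_insert ha, Finset.prod_insert ha, nexp_add, ih]

lemma nexp_nlog {y : ℝ≥0∞} (hy : y ≤ 1) : nexp (nlog y) = y := by
  have h : 0 ≤ -(ENNReal.log y) := by
    rw [EReal.le_neg]; simpa using hy
  rw [nexp, nlog, EReal.coe_toENNReal h, neg_neg, ENNReal.exp_log]

lemma antitone_nlog : Antitone nlog := fun _ _ h =>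
  EReal.toENNReal_le_toENNReal (EReal.neg_le_neg_iff.2 (ENNReal.log_monotone h))

@[fun_prop]
lemma measurable_nlog : Measurable nlog := by
  unfold nlog
  exact measurable_ereal_toENNReal.comp (measurable_neg.comp ENNReal.measurable_log)

lemma one_sub_nexp_ofReal {x : ℝ} (hx : 0 ≤ x) :
    1 - nexp (ENNReal.ofReal x) = ENNReal.ofReal (∫ t in (0 : ℝ)..x, Real.exp (-t)) := by
  have : ∫ t in (0 : ℝ)..x, Real.exp (-t) = 1 - Real.exp (-x) := by
    simp
  rw [this, nexp_ofReal hx, ENNReal.ofReal_sub _ (Real.exp_nonneg _), ENNReal.ofReal_one]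

lemma lintegral_exp_neg_mul_rpow {s : ℝ} (hs : 0 < s) :
    ∫⁻ t in Set.Ioi (0 : ℝ), ENNReal.ofReal (Real.exp (-t)) * ENNReal.ofReal (t ^ (s - 1)) =
      ENNReal.ofReal (Real.Gamma s) := by
  rw [Real.Gamma_eq_integral hs,
    ofReal_integral_eq_lintegral_ofReal (Real.GammaIntegral_convergent hs)]
  · exact lintegral_congr fun t => (ENNReal.ofReal_mul (Real.exp_nonneg _)).symm
  · filter_upwards [ae_restrict_mem measurableSet_Ioi] with t ht
    exact mul_nonneg (Real.exp_nonneg _) (Real.rpow_nonneg (le_of_lt ht) _)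

lemma volume_le_mul_norm_rpow {α c t : ℝ} (hα : 0 < α) (hc : 0 < c) (ht : 0 < t) :
    volume {u : Plane | t ≤ c * ‖u‖ ^ (-α)} =
      ENNReal.ofReal (Real.pi * c ^ (2 / α)) * ENNReal.ofReal (t ^ (-(2 / α))) := by
  have h1 : {u : Plane | t ≤ c * ‖u‖ ^ (-α)} = Metric.closedBall 0 ((c / t) ^ (1 / α)) \ {0} := by
    ext u
    simp only [Set.mem_ofPred_eq, Set.mem_sdiff, mem_closedBall_zero_iff, Set.mem_singleton_iff]
    rcases eq_or_ne u 0 with rfl | hu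
    · simp [Real.zero_rpow (neg_ne_zero.2 hα.ne'), ht]
    · have hn : 0 < ‖u‖ := norm_pos_iff.2 hu
      have hp : 0 < ‖u‖ ^ α := Real.rpow_pos_of_pos hn _
      rw [Real.rpow_neg hn.le, ← div_eq_mul_inv, le_div_iff₀ hp, one_div,
        Real.le_rpow_inv_iff_of_pos hn.le (by positivity) hα, le_div_iff₀ ht, mul_comm]
      simp [hu]
  rw [h1, measure_sdiff_null (by simp), EuclideanSpace.volume_closedBall_fin_two,
    ← ENNReal.ofReal_pow (by positivity), ← ENNReal.ofReal_mul (by positivity),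
    ← ENNReal.ofReal_mul (by positivity), ← Real.rpow_natCast, ← Real.rpow_mul (by positivity),
    Real.div_rpow hc.le ht.le, Real.rpow_neg ht.le]
  congr 1
  have : 1 / α * ((2 : ℕ) : ℝ) = 2 / α := by push_cast; ring
  rw [this]; ring

/-- The path loss integral over the plane. -/
lemma lintegral_one_sub_nexp_norm {α c : ℝ} (hα : 2 < α) (hc : 0 ≤ c) :
    ∫⁻ u : Plane, (1 - nexp (ENNReal.ofReal c * ENNReal.ofReal ‖u‖ ^ (-α))) =
      ENNReal.ofReal (Real.pi * c ^ (2 / α) * Real.Gamma (1 - 2 / α)) := by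
  have hα0 : 0 < α := by linarith
  rcases hc.eq_or_lt with rfl | hc
  · simp [Real.zero_rpow (div_pos two_pos hα0).ne']
  have h1 : ∀ᵐ u : Plane, 1 - nexp (ENNReal.ofReal c * ENNReal.ofReal ‖u‖ ^ (-α)) =
      ENNReal.ofReal (∫ t in (0 : ℝ)..(c * ‖u‖ ^ (-α)), Real.exp (-t)) := by
    have : ∀ᵐ u : Plane, u ≠ 0 := by simp [ae_iff]
    filter_upwards [this] with u hu
    rw [ENNReal.ofReal_rpow_of_pos (norm_pos_iff.2 hu), ← ENNReal.ofReal_mul hc.le,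
      one_sub_nexp_ofReal (by positivity)]
  rw [lintegral_congr_ae h1, lintegral_comp_eq_lintegral_meas_le_mul]
  · have h2 : ∀ t ∈ Set.Ioi (0 : ℝ), volume {u : Plane | t ≤ c * ‖u‖ ^ (-α)} *
        ENNReal.ofReal (Real.exp (-t)) = ENNReal.ofReal (Real.pi * c ^ (2 / α)) *
        (ENNReal.ofReal (Real.exp (-t)) * ENNReal.ofReal (t ^ ((1 - 2 / α) - 1))) := by
      intro t ht
      rw [volume_le_mul_norm_rpow hα0 hc ht]
      have : (1 - 2 / α) - 1 = -(2 / α) := by ring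
      rw [this]; ring
    rw [setLIntegral_congr_fun measurableSet_Ioi h2, lintegral_const_mul' _ _ (by simp),
      lintegral_exp_neg_mul_rpow, ← ENNReal.ofReal_mul (by positivity)]
    rw [sub_pos, div_lt_one hα0]; exact hα
  · exact Eventually.of_forall fun u => by positivity
  · fun_prop
  · intro t _
    exact (by fun_prop : Continuous fun t : ℝ => Real.exp (-t)).intervalIntegrable _ _
  · exact Eventually.of_forall fun t => by positivity

lemma Gamma_mul_Gamma_eq_inv_nsinc {a : ℝ} (ha : 0 < a) :
    Real.Gamma (1 + a) * Real.Gamma (1 - a) = (nsinc a)⁻¹ := by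
  rw [add_comm, Real.Gamma_add_one ha.ne', mul_assoc, Real.Gamma_mul_Gamma_one_sub, nsinc,
    Real.sinc_of_ne_zero (by positivity), inv_div]
  ring

lemma nsinc_pos {a : ℝ} (ha : 0 < a) (ha' : a < 1) : 0 < nsinc a := by
  rw [nsinc, Real.sinc_of_ne_zero (by positivity)]
  have := Real.sin_pos_of_pos_of_lt_pi (x := Real.pi * a) (by positivity)
    (by nlinarith [Real.pi_pos])
  positivity

instance : IsProbabilityMeasure complexGaussian := by
  unfold complexGaussian
  exact Measure.isProbabilityMeasure_map
    (Complex.measurableEquivRealProd.symm.measurable).aemeasurable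

lemma complexGaussian_eq_withDensity :
    complexGaussian = volume.withDensity
      fun z : ℂ => ENNReal.ofReal (Real.pi⁻¹ * Real.exp (-‖z‖ ^ 2)) := by
  have hv : (1 / 2 : ℝ≥0) ≠ 0 := by norm_num
  have h1 : complexGaussian = ((gaussianReal 0 (1 / 2)).prod (gaussianReal 0 (1 / 2))).map
      Complex.measurableEquivRealProd.symm := rfl
  ext s hs
  rw [h1, Measure.map_apply Complex.measurableEquivRealProd.symm.measurable hs,
    gaussianReal_of_var_ne_zero _ hv,
    prod_withDensity (measurable_gaussianPDF _ _) (measurable_gaussianPDF _ _),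
    withDensity_apply _ hs, withDensity_apply _ (Complex.measurableEquivRealProd.symm.measurable hs),
    ← Measure.volume_eq_prod,
    ← (Complex.volume_preserving_equiv_real_prod.symm _).setLIntegral_comp_preimage_emb
      (MeasurableEquiv.measurableEmbedding _)]
  refine lintegral_congr fun x => ?_
  rw [gaussianPDF, gaussianPDF, ← ENNReal.ofReal_mul (gaussianPDFReal_nonneg _ _ _)]
  congr 1
  simp only [gaussianPDFReal]
  rw [← Complex.normSq_eq_norm_sq, Complex.normSq_apply]
  have h2 : 2 * Real.pi * ((1 / 2 : ℝ≥0) : ℝ) = Real.pi := by push_cast; ring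
  have h3 : (Real.sqrt Real.pi)⁻¹ * (Real.sqrt Real.pi)⁻¹ = Real.pi⁻¹ := by
    rw [← mul_inv, Real.mul_self_sqrt Real.pi_pos.le]
  rw [h2, mul_mul_mul_comm, h3, ← Real.exp_add]
  congr 2
  simp
  ring

lemma complexGaussian_le_norm_sq_of_real {t : ℝ} (ht : 0 ≤ t) :
    complexGaussian {g | t ≤ ‖g‖ ^ 2} = ENNReal.ofReal (Real.exp (-t)) := by
  have hm : MeasurableSet {g : ℂ | t ≤ ‖g‖ ^ 2} := measurableSet_le (by fun_prop) (by fun_prop)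
  rw [complexGaussian_eq_withDensity, withDensity_apply _ hm, ← lintegral_indicator hm,
    ← Complex.lintegral_comp_polarCoord_symm, polarCoord_target, Measure.volume_eq_prod,
    ← Measure.prod_restrict]
  have h1 : ∀ᵐ p : ℝ × ℝ ∂((volume.restrict (Set.Ioi 0)).prod
      (volume.restrict (Set.Ioo (-Real.pi) Real.pi))),
      ENNReal.ofReal p.1 • {g : ℂ | t ≤ ‖g‖ ^ 2}.indicator
        (fun z => ENNReal.ofReal (Real.pi⁻¹ * Real.exp (-‖z‖ ^ 2))) (Complex.polarCoord.symm p) =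
      (Set.Ioi (Real.sqrt t)).indicator
        (fun r => ENNReal.ofReal (Real.pi⁻¹ * (r * Real.exp (-r ^ 2)))) p.1 := by
    have hne : ∀ᵐ r : ℝ ∂(volume.restrict (Set.Ioi (0 : ℝ))), r ≠ Real.sqrt t ∧ 0 < r := by
      refine Eventually.and ?_ (ae_restrict_mem measurableSet_Ioi)
      exact ae_restrict_of_ae (by simp [ae_iff])
    have := Measure.quasiMeasurePreserving_fst (μ := volume.restrict (Set.Ioi (0 : ℝ)))
      (ν := volume.restrict (Set.Ioo (-Real.pi) Real.pi)) |>.ae hne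
    filter_upwards [this] with p hp
    have hn : ‖Complex.polarCoord.symm p‖ = p.1 := by
      rw [Complex.norm_polarCoord_symm, abs_of_pos hp.2]
    by_cases h : Real.sqrt t < p.1
    · rw [Set.indicator_of_mem, Set.indicator_of_mem (Set.mem_Ioi.2 h), hn, smul_eq_mul,
        ← ENNReal.ofReal_mul hp.2.le]
      · congr 1; ring
      · rw [Set.mem_ofPred_eq, hn]; exact (Real.sqrt_le_left hp.2.le).1 h.le
    · rw [Set.indicator_of_notMem, Set.indicator_of_notMem (by simpa using h), smul_zero]
      rw [Set.mem_ofPred_eq, hn, ← Real.sqrt_le_left hp.2.le]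
      exact fun h' => h (lt_of_le_of_ne h' hp.1.symm)
  rw [lintegral_congr_ae h1, lintegral_prod _ (by
    refine Measurable.aemeasurable ?_
    refine (Measurable.indicator (by fun_prop) measurableSet_Ioi).comp measurable_fst)]
  simp only [lintegral_const, Measure.restrict_apply MeasurableSet.univ, Set.univ_inter,
    Real.volume_Ioo]
  rw [lintegral_mul_const' _ _ (by simp), setLIntegral_indicator measurableSet_Ioi,
    Set.inter_eq_left.2 (Set.Ioi_subset_Ioi (Real.sqrt_nonneg t))]
  have hd : ∀ x ∈ Set.Ici (Real.sqrt t),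
      HasDerivAt (fun r : ℝ => -(2⁻¹ * Real.exp (-r ^ 2))) (x * Real.exp (-x ^ 2)) x := by
    intro x _
    have h2 : HasDerivAt (fun r : ℝ => -r ^ 2) (-(2 * x)) x := by
      convert! (hasDerivAt_pow 2 x).neg using 1
      simp
    convert! (h2.exp.const_mul 2⁻¹).neg using 1
    ring
  have hlim : Tendsto (fun r : ℝ => -(2⁻¹ * Real.exp (-r ^ 2))) atTop (𝓝 0) := by
    have : Tendsto (fun r : ℝ => Real.exp (-r ^ 2)) atTop (𝓝 0) :=
      Real.tendsto_exp_atBot.comp (tendsto_neg_atTop_atBot.comp (tendsto_pow_atTop two_ne_zero))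
    simpa using (this.const_mul 2⁻¹).neg
  have hpos : ∀ x ∈ Set.Ioi (Real.sqrt t), 0 ≤ x * Real.exp (-x ^ 2) := fun x hx =>
    mul_nonneg ((Real.sqrt_nonneg t).trans (le_of_lt hx)) (Real.exp_nonneg _)
  have hint := integrableOn_Ioi_deriv_of_nonneg' hd hpos hlim
  have hval := integral_Ioi_of_hasDerivAt_of_nonneg' hd hpos hlim
  rw [← ofReal_integral_eq_lintegral_ofReal (hint.const_mul _)
    ((ae_restrict_mem measurableSet_Ioi).mono fun x hx => mul_nonneg (by positivity) (hpos x hx)),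
    integral_const_mul, hval, ← ENNReal.ofReal_mul (by
      have := Real.exp_nonneg (-Real.sqrt t ^ 2)
      have := Real.pi_pos
      simp only [zero_sub, neg_neg]; positivity), Real.sq_sqrt ht]
  congr 1
  field_simp
  ring

/-- The squared modulus of a standard complex Gaussian is exponentially distributed. -/
lemma complexGaussian_le_norm_sq (t : ℝ≥0∞) :
    complexGaussian {g | t ≤ ENNReal.ofReal (‖g‖ ^ 2)} = nexp t := by
  rcases eq_or_ne t ∞ with rfl | ht
  · simp
  · rw [nexp_of_ne_top ht, ← complexGaussian_le_norm_sq_of_real ENNReal.toReal_nonneg]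
    congr with g
    rw [ENNReal.le_ofReal_iff_toReal_le ht (by positivity)]

lemma complexGaussian_moment {a : ℝ} (ha : 0 < a) :
    ∫⁻ g, ENNReal.ofReal ((‖g‖ ^ 2) ^ a) ∂complexGaussian = ENNReal.ofReal (Real.Gamma (1 + a)) := by
  rw [lintegral_rpow_eq_lintegral_meas_le_mul _ (Eventually.of_forall fun g => by positivity)
    (by fun_prop) ha, add_comm, Real.Gamma_add_one ha.ne', ENNReal.ofReal_mul ha.le,
    ← lintegral_exp_neg_mul_rpow ha]
  congr 1
  refine setLIntegral_congr_fun measurableSet_Ioi fun t ht => ?_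
  rw [complexGaussian_le_norm_sq_of_real (le_of_lt ht)]

lemma ae_complexGaussian_ne_zero : ∀ᵐ g ∂complexGaussian, g ≠ 0 := by
  rw [complexGaussian_eq_withDensity]
  exact (withDensity_absolutelyContinuous _ _).ae_le (Measure.ae_ne _ _)

section Poisson

variable {Ω : Type*}

/-- The sum of `g` over all the points of the point process. -/
def shot (X : ℕ → Ω → Plane) (g : Plane → ℝ≥0∞) (ω : Ω) : ℝ≥0∞ := ∑' l, g (X l ω)

lemma coe_count_eq_shot (X : ℕ → Ω → Plane) (B : Set Plane) (ω : Ω) :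
    (count X B ω : ℝ≥0∞) = shot X (B.indicator 1) ω := by
  rw [count, ← ENNReal.tsum_set_one, tsum_subtype _ fun _ => 1, shot]
  exact tsum_congr fun l => by simp [Set.indicator]

variable [MeasurableSpace Ω]

lemma measurable_shot {X : ℕ → Ω → Plane} (hX : ∀ i, Measurable (X i)) {g : Plane → ℝ≥0∞}
    (hg : Measurable g) : Measurable (shot X g) :=
  Measurable.tsum fun l => hg.comp (hX l)

lemma measurable_count {X : ℕ → Ω → Plane} (hX : ∀ i, Measurable (X i)) {B : Set Plane}
    (hB : MeasurableSet B) : Measurable (count X B) := by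
  refine measurable_to_countable' fun n => ?_
  have h : count X B ⁻¹' {n} = shot X (B.indicator 1) ⁻¹' {(n : ℝ≥0∞)} := by
    ext ω
    simp [← coe_count_eq_shot]
  rw [h]
  exact measurable_shot hX (measurable_one.indicator hB) (measurableSet_singleton _)

lemma lintegral_nexp_poissonMeasure (r : ℝ≥0) {c : ℝ≥0∞} (hc : c ≠ ∞) :
    ∫⁻ n : ℕ, nexp (c * n) ∂(poissonMeasure r) = nexp (r * (1 - nexp c)) := by
  obtain ⟨c, rfl⟩ : ∃ x : ℝ≥0, c = ENNReal.ofReal x :=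
    ⟨c.toNNReal, by rw [ENNReal.ofReal_coe_nnreal, ENNReal.coe_toNNReal hc]⟩
  have h1 : ∀ n : ℕ, nexp (ENNReal.ofReal c * n) * poissonMeasure r {n} =
      ENNReal.ofReal (Real.exp (-r) * ((r * Real.exp (-c)) ^ n / n.factorial)) := by
    intro n
    rw [poissonMeasure_singleton, ← ENNReal.ofReal_natCast, ← ENNReal.ofReal_mul c.coe_nonneg,
      nexp_ofReal (by positivity), ← ENNReal.ofReal_mul (by positivity), mul_pow, ← Real.exp_nat_mul]
    congr 1
    have : -((c : ℝ) * n) = n * -(c : ℝ) := by ring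
    rw [this]; ring
  have h2 := (NormedSpace.expSeries_div_hasSum_exp ((r : ℝ) * Real.exp (-c))).mul_left
    (Real.exp (-r))
  rw [lintegral_countable']
  simp_rw [h1]
  rw [← ENNReal.ofReal_tsum_of_nonneg (fun n => by positivity) h2.summable, h2.tsum_eq,
    ← Real.exp_eq_exp_ℝ, ← Real.exp_add, nexp_ofReal c.coe_nonneg, ← ENNReal.ofReal_one,
    ← ENNReal.ofReal_sub _ (Real.exp_nonneg _), ← ENNReal.ofReal_coe_nnreal (p := r),
    ← ENNReal.ofReal_mul r.coe_nonneg, nexp_ofReal]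
  · congr 2; ring
  · exact mul_nonneg r.coe_nonneg (by simp)

namespace IsHomogeneousPoissonProcess

variable {P : Measure Ω} [IsProbabilityMeasure P] {lam : ℝ} {X : ℕ → Ω → Plane}

lemma ae_count_ne_top (hX : IsHomogeneousPoissonProcess P lam X) {B : Set Plane}
    (hB : MeasurableSet B) (hB' : volume B ≠ ∞) : ∀ᵐ ω ∂P, count X B ω ≠ ⊤ := by
  set r := (ENNReal.ofReal lam * volume B).toNNReal
  have hm := measurable_count hX.measurable hB
  have h1 : P (⋃ n : ℕ, count X B ⁻¹' {(n : ℕ∞)}) = 1 := by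
    rw [measure_iUnion _ fun n => hm (measurableSet_singleton _)]
    · have : ∀ n : ℕ, P (count X B ⁻¹' {(n : ℕ∞)}) = poissonMeasure r {n} :=
        fun n => hX.poisson B hB hB' n
      simp_rw [this]
      rw [← measure_iUnion _ fun n => measurableSet_singleton _, Set.iUnion_of_singleton,
        measure_univ]
      exact fun i j hij => by simpa using hij
    · intro i j hij
      exact Disjoint.preimage _ (by simpa using hij)
  have h2 : ∀ᵐ ω ∂P, ω ∈ ⋃ n : ℕ, count X B ⁻¹' {(n : ℕ∞)} :=
    (prob_compl_eq_zero_iff (MeasurableSet.iUnion fun n => hm (measurableSet_singleton _))).2 h1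
  filter_upwards [h2] with ω hω
  obtain ⟨n, hn⟩ := Set.mem_iUnion.1 hω
  rw [Set.mem_preimage, Set.mem_singleton_iff] at hn
  simp [hn]

lemma lintegral_comp_count (hX : IsHomogeneousPoissonProcess P lam X) {B : Set Plane}
    (hB : MeasurableSet B) (hB' : volume B ≠ ∞) (f : ℕ∞ → ℝ≥0∞) :
    ∫⁻ ω, f (count X B ω) ∂P =
      ∫⁻ n : ℕ, f n ∂(poissonMeasure (ENNReal.ofReal lam * volume B).toNNReal) := by
  have hm := measurable_count hX.measurable hB
  have h : P.map (count X B) =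
      (poissonMeasure (ENNReal.ofReal lam * volume B).toNNReal).map (fun n : ℕ => (n : ℕ∞)) := by
    refine Measure.ext_of_singleton fun n => ?_
    rw [Measure.map_apply hm (measurableSet_singleton _),
      Measure.map_apply (Measurable.of_discrete) (measurableSet_singleton _)]
    induction n using ENat.recTopCoe with
    | top =>
      have h1 : P (count X B ⁻¹' {⊤}) = 0 := by
        have := hX.ae_count_ne_top hB hB'
        rw [ae_iff] at this
        simpa [Set.preimage] using this
      rw [h1]
      have h2 : (fun n : ℕ => (n : ℕ∞)) ⁻¹' {⊤} = ∅ := by ext n; simp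
      rw [h2, measure_empty]
    | coe n =>
      have h2 : (fun n : ℕ => (n : ℕ∞)) ⁻¹' {(n : ℕ∞)} = {n} := by ext m; simp
      rw [h2]
      exact hX.poisson B hB hB' n
  rw [← lintegral_map (μ := P) (f := f) Measurable.of_discrete hm, h,
    lintegral_map Measurable.of_discrete Measurable.of_discrete]

lemma lintegral_nexp_count (hX : IsHomogeneousPoissonProcess P lam X) {B : Set Plane}
    (hB : MeasurableSet B) (hB' : volume B ≠ ∞) {c : ℝ≥0∞} (hc : c ≠ ∞) :
    ∫⁻ ω, nexp (c * count X B ω) ∂P =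
      nexp (ENNReal.ofReal lam * volume B * (1 - nexp c)) := by
  rw [hX.lintegral_comp_count hB hB' fun n => nexp (c * n)]
  simp only [ENat.toENNReal_coe]
  rw [lintegral_nexp_poissonMeasure _ hc,
    ENNReal.coe_toNNReal (ENNReal.mul_ne_top ENNReal.ofReal_ne_top hB')]

end IsHomogeneousPoissonProcess

lemma _root_.MeasureTheory.SimpleFunc.comp_eq_sum_indicator {m : ℕ} (g : SimpleFunc Plane ℝ≥0∞)
    (e : Fin m ≃ {c // c ∈ g.range.filter (· ≠ 0)}) (F : ℝ≥0∞ → ℝ≥0∞) (hF : F 0 = 0) (x : Plane) :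
    F (g x) = ∑ j, F (e j) * (g ⁻¹' {(e j : ℝ≥0∞)}).indicator 1 x := by
  rw [e.sum_comp fun c : {c // c ∈ g.range.filter (· ≠ 0)} =>
    F c * (g ⁻¹' {(c : ℝ≥0∞)}).indicator 1 x,
    Finset.sum_coe_sort (g.range.filter (· ≠ 0))
      fun c => F c * (g ⁻¹' {c}).indicator (1 : Plane → ℝ≥0∞) x]
  by_cases h : g x = 0
  · rw [h, hF, Finset.sum_eq_zero]
    intro c hc
    rw [Set.indicator_of_notMem, mul_zero]
    simp only [Set.mem_preimage, Set.mem_singleton_iff, h]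
    exact fun h' => (Finset.mem_filter.1 hc).2 h'.symm
  · rw [Finset.sum_eq_single_of_mem (g x) (by simp [h])]
    · simp
    · intro c _ hc
      rw [Set.indicator_of_notMem, mul_zero]
      simpa using hc.symm

namespace IsHomogeneousPoissonProcess

variable {P : Measure Ω} [IsProbabilityMeasure P] {lam : ℝ} {X : ℕ → Ω → Plane}

lemma lintegral_nexp_shot_simpleFunc (hX : IsHomogeneousPoissonProcess P lam X)
    (g : SimpleFunc Plane ℝ≥0∞) (hg : ∀ x, g x ≠ ∞) (hs : volume (Function.support g) ≠ ∞) :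
    ∫⁻ ω, nexp (shot X g ω) ∂P = nexp (ENNReal.ofReal lam * ∫⁻ x, (1 - nexp (g x))) := by
  obtain ⟨m, ⟨e⟩⟩ : ∃ m, Nonempty (Fin m ≃ {c // c ∈ g.range.filter (· ≠ 0)}) :=
    ⟨_, ⟨(Finset.equivFin _).symm⟩⟩
  set B : Fin m → Set Plane := fun j => g ⁻¹' {(e j : ℝ≥0∞)} with hBdef
  have hBm : ∀ j, MeasurableSet (B j) := fun j => g.measurableSet_preimage _
  have hBv : ∀ j, volume (B j) ≠ ∞ := fun j => by
    refine ne_top_of_le_ne_top hs (measure_mono fun x hx => ?_)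
    rw [Function.mem_support, show g x = e j from hx]
    exact (Finset.mem_filter.1 (e j).2).2
  have hBd : Pairwise fun i j => Disjoint (B i) (B j) := by
    intro i j hij
    refine Disjoint.preimage _ ?_
    simpa [Subtype.coe_inj] using hij
  have hc : ∀ j, (e j : ℝ≥0∞) ≠ ∞ := fun j => by
    obtain ⟨x, hx⟩ := SimpleFunc.mem_range.1 (Finset.mem_filter.1 (e j).2).1
    rw [← hx]; exact hg x
  have h1 : ∀ ω, nexp (shot X g ω) = ∏ j, nexp (e j * count X (B j) ω) := by
    intro ω
    rw [← nexp_sum]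
    congr 1
    simp_rw [coe_count_eq_shot, shot, ← ENNReal.tsum_mul_left]
    rw [← Summable.tsum_finsetSum fun _ _ => ENNReal.summable]
    exact tsum_congr fun l => g.comp_eq_sum_indicator e id rfl (X l ω)
  simp_rw [h1]
  have hind : iIndepFun (fun j ω => nexp (e j * count X (B j) ω)) P :=
    (hX.indep m B hBm hBv hBd).comp (fun j (n : ℕ∞) => nexp (e j * n))
      fun j => Measurable.of_discrete
  rw [lintegral_prod_eq_prod_lintegral_of_indepFun _ _ hind fun j =>
    (Measurable.of_discrete (f := fun n : ℕ∞ => nexp (e j * n))).comp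
      (measurable_count hX.measurable (hBm j))]
  rw [Finset.prod_congr rfl fun j _ => hX.lintegral_nexp_count (hBm j) (hBv j) (hc j), ← nexp_sum]
  congr 1
  simp_rw [fun x => g.comp_eq_sum_indicator e (fun c => 1 - nexp c) (by simp) x]
  rw [lintegral_finsetSum _ fun j _ =>
    (measurable_one.indicator (hBm j)).const_mul _, Finset.mul_sum]
  refine Finset.sum_congr rfl fun j _ => ?_
  rw [lintegral_const_mul _ (measurable_one.indicator (hBm j)), lintegral_indicator_one (hBm j)]
  ring

/-- The Laplace functional of a homogeneous Poisson process. -/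
theorem lintegral_nexp_shot (hX : IsHomogeneousPoissonProcess P lam X) {g : Plane → ℝ≥0∞}
    (hg : Measurable g) :
    ∫⁻ ω, nexp (shot X g ω) ∂P = nexp (ENNReal.ofReal lam * ∫⁻ x, (1 - nexp (g x))) := by
  set G : ℕ → SimpleFunc Plane ℝ≥0∞ := fun n =>
    (SimpleFunc.eapprox g n).restrict (Metric.closedBall 0 n) with hG
  have hGa : ∀ n x, G n x = (Metric.closedBall (0 : Plane) n).indicator (SimpleFunc.eapprox g n) x :=
    fun n x => by rw [hG, SimpleFunc.restrict_apply _ Metric.isClosed_closedBall.measurableSet]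
  have hmono : ∀ x, Monotone fun n => G n x := by
    intro x m n hmn
    simp only [hGa]
    refine (Set.indicator_le_indicator (SimpleFunc.monotone_eapprox g hmn x)).trans ?_
    exact Set.indicator_le_indicator_of_subset
      (Metric.closedBall_subset_closedBall (by exact_mod_cast hmn)) (fun _ => zero_le) x
  have hlim : ∀ x, Tendsto (fun n => G n x) atTop (𝓝 (g x)) := by
    intro x
    refine (SimpleFunc.tendsto_eapprox hg x).congr' ?_
    obtain ⟨N, hN⟩ := exists_nat_ge ‖x‖
    filter_upwards [eventually_ge_atTop N] with n hn
    rw [hGa, Set.indicator_of_mem]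
    rw [mem_closedBall_zero_iff]
    exact hN.trans (by exact_mod_cast hn)
  have hshot : ∀ ω, Tendsto (fun n => shot X (G n) ω) atTop (𝓝 (shot X g ω)) := by
    intro ω
    simp_rw [shot, ← lintegral_count]
    exact lintegral_tendsto_of_tendsto_of_monotone (fun n => Measurable.of_discrete.aemeasurable)
      (Eventually.of_forall fun l => hmono _) (Eventually.of_forall fun l => hlim _)
  have hL : Tendsto (fun n => ∫⁻ ω, nexp (shot X (G n) ω) ∂P) atTop
      (𝓝 (∫⁻ ω, nexp (shot X g ω) ∂P)) := by
    refine tendsto_lintegral_of_dominated_convergence (fun _ => 1)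
      (fun n => measurable_nexp.comp (measurable_shot hX.measurable (G n).measurable))
      (fun n => Eventually.of_forall fun ω => nexp_le_one _) (by simp)
      (Eventually.of_forall fun ω => (continuous_nexp.tendsto _).comp (hshot ω))
  have hR : Tendsto (fun n => nexp (ENNReal.ofReal lam * ∫⁻ x, (1 - nexp (G n x)))) atTop
      (𝓝 (nexp (ENNReal.ofReal lam * ∫⁻ x, (1 - nexp (g x))))) := by
    refine (continuous_nexp.tendsto _).comp (ENNReal.Tendsto.const_mul ?_
      (Or.inr ENNReal.ofReal_ne_top))
    refine lintegral_tendsto_of_tendsto_of_monotone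
      (fun n => (measurable_const.sub (measurable_nexp.comp (G n).measurable)).aemeasurable)
      (Eventually.of_forall fun x m n hmn => tsub_le_tsub_left (antitone_nexp (hmono x hmn)) _)
      (Eventually.of_forall fun x => ?_)
    exact ENNReal.Tendsto.sub tendsto_const_nhds ((continuous_nexp.tendsto _).comp (hlim x))
      (Or.inl ENNReal.one_ne_top)
  refine tendsto_nhds_unique hL (hR.congr fun n => ?_)
  rw [hX.lintegral_nexp_shot_simpleFunc]
  · intro x
    rw [hGa]
    refine ne_top_of_le_ne_top (SimpleFunc.eapprox_lt_top g n x).ne (Set.indicator_le_self _ _ _)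
  · refine ne_top_of_le_ne_top (measure_closedBall_lt_top (x := (0 : Plane)) (r := n)).ne
      (measure_mono fun x hx => ?_)
    by_contra h
    exact hx (by rw [hGa, Set.indicator_of_notMem h])

end IsHomogeneousPoissonProcess
end Poisson

section Poisson

variable {Ω : Type*}

lemma tendsto_succ_mul_of_hasDerivAt_zero {f : ℝ → ℝ} {c : ℝ} (hf : HasDerivAt f c 0)
    (h0 : f 0 = 0) :
    Tendsto (fun n : ℕ => ((n : ℝ) + 1) * f (1 / ((n : ℝ) + 1))) atTop (𝓝 c) := by
  have h1 := hasDerivAt_iff_tendsto_slope_zero.1 hf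
  have h2 : Tendsto (fun n : ℕ => 1 / ((n : ℝ) + 1)) atTop (𝓝[≠] 0) :=
    tendsto_nhdsWithin_iff.2 ⟨tendsto_one_div_add_atTop_nhds_zero_nat,
      Eventually.of_forall fun n => by
        simp only [Set.mem_compl_iff, Set.mem_singleton_iff]; positivity⟩
  refine (h1.comp h2).congr fun n => ?_
  simp [h0]

lemma succ_mul_one_sub_nexp_le (n : ℕ) (x : ℝ≥0∞) :
    ((n : ℝ≥0∞) + 1) * (1 - nexp (((n : ℝ≥0∞) + 1)⁻¹ * x)) ≤ x := by
  have h : ∀ y : ℝ≥0∞, 1 - nexp y ≤ y := by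
    intro y
    rcases eq_or_ne y ∞ with rfl | hy
    · simp
    · rw [nexp_of_ne_top hy, ← ENNReal.ofReal_one, ← ENNReal.ofReal_sub _ (Real.exp_nonneg _)]
      refine ENNReal.ofReal_le_of_le_toReal ?_
      linarith [Real.add_one_le_exp (-y.toReal)]
  refine (mul_le_mul_right (h _) _).trans ?_
  rw [← mul_assoc, ENNReal.mul_inv_cancel (by simp) (by simp), one_mul]

lemma tendsto_succ_mul_one_sub_nexp {x : ℝ≥0∞} (hx : x ≠ ∞) :
    Tendsto (fun n : ℕ => ((n : ℝ≥0∞) + 1) * (1 - nexp (((n : ℝ≥0∞) + 1)⁻¹ * x))) atTop (𝓝 x) := by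
  have hd : HasDerivAt (fun t : ℝ => 1 - Real.exp (-(t * x.toReal))) x.toReal 0 := by
    have h1 : HasDerivAt (fun t : ℝ => -(t * x.toReal)) (-x.toReal) 0 := by
      simpa using ((hasDerivAt_id (0 : ℝ)).mul_const x.toReal).fun_neg
    simpa using h1.exp.const_sub 1
  have h := ENNReal.tendsto_ofReal (tendsto_succ_mul_of_hasDerivAt_zero hd (by simp))
  rw [ENNReal.ofReal_toReal hx] at h
  refine h.congr fun n => ?_
  have hn : ((n : ℝ≥0∞) + 1) = ENNReal.ofReal ((n : ℝ) + 1) := by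
    rw [ENNReal.ofReal_add (by positivity) zero_le_one]; simp
  rw [nexp_of_ne_top (ENNReal.mul_ne_top (by simp) hx), ENNReal.toReal_mul, hn,
    ENNReal.toReal_inv, ENNReal.toReal_ofReal (by positivity), ENNReal.ofReal_mul (by positivity),
    ENNReal.ofReal_sub _ (Real.exp_nonneg _), ENNReal.ofReal_one, one_div]

lemma tendsto_succ_mul_one_sub_nexp_mul_one_sub_nexp {c : ℝ≥0∞} (hc : c ≠ ∞) :
    Tendsto (fun n : ℕ => ((n : ℝ≥0∞) + 1) *
      (1 - nexp (c * (1 - nexp ((n : ℝ≥0∞) + 1)⁻¹)))) atTop (𝓝 c) := by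
  have hd : HasDerivAt (fun t : ℝ => 1 - Real.exp (-(c.toReal * (1 - Real.exp (-t)))))
      c.toReal 0 := by
    have h0 : HasDerivAt (fun t : ℝ => -(c.toReal * (1 - Real.exp (-t)))) (-c.toReal) 0 := by
      simpa using (((hasDerivAt_neg (0 : ℝ)).exp.const_sub 1).const_mul c.toReal).fun_neg
    simpa using h0.exp.const_sub 1
  have h := ENNReal.tendsto_ofReal (tendsto_succ_mul_of_hasDerivAt_zero hd (by simp))
  rw [ENNReal.ofReal_toReal hc] at h
  refine h.congr fun n => ?_
  have hn : ((n : ℝ≥0∞) + 1) = ENNReal.ofReal ((n : ℝ) + 1) := by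
    rw [ENNReal.ofReal_add (by positivity) zero_le_one]; simp
  have h1 : ((n : ℝ≥0∞) + 1)⁻¹ ≠ ∞ := by simp
  have h2 : 1 - nexp ((n : ℝ≥0∞) + 1)⁻¹ ≠ ∞ := ne_top_of_le_ne_top ENNReal.one_ne_top tsub_le_self
  have h3 : (1 - nexp ((n : ℝ≥0∞) + 1)⁻¹).toReal = 1 - Real.exp (-(1 / ((n : ℝ) + 1))) := by
    rw [ENNReal.toReal_sub_of_le (nexp_le_one _) ENNReal.one_ne_top, nexp_of_ne_top h1,
      ENNReal.toReal_ofReal (Real.exp_nonneg _), hn, ENNReal.toReal_inv,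
      ENNReal.toReal_ofReal (by positivity), one_div, ENNReal.toReal_one]
  rw [nexp_of_ne_top (ENNReal.mul_ne_top hc h2), ENNReal.toReal_mul, h3, hn,
    ENNReal.ofReal_mul (by positivity), ENNReal.ofReal_sub _ (Real.exp_nonneg _),
    ENNReal.ofReal_one]

lemma shot_add (X : ℕ → Ω → Plane) (f g : Plane → ℝ≥0∞) (ω : Ω) :
    shot X (fun x => f x + g x) ω = shot X f ω + shot X g ω :=
  ENNReal.tsum_add

lemma shot_const_mul (X : ℕ → Ω → Plane) (c : ℝ≥0∞) (g : Plane → ℝ≥0∞) (ω : Ω) :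
    shot X (fun x => c * g x) ω = c * shot X g ω :=
  ENNReal.tsum_mul_left

lemma tsum_eq_add_tsum_ne {ι : Type*} (f : ι → ℝ≥0∞) (k : ι) :
    ∑' l, f l = f k + ∑' l : {l // l ≠ k}, f l := by
  rw [← Summable.tsum_add_tsum_compl (s := {k}) ENNReal.summable ENNReal.summable, tsum_singleton]
  rfl

variable [MeasurableSpace Ω]

namespace IsHomogeneousPoissonProcess

variable {P : Measure Ω} [IsProbabilityMeasure P] {lam : ℝ} {X : ℕ → Ω → Plane}

lemma lintegral_nexp_shot_mul_one_sub (hX : IsHomogeneousPoissonProcess P lam X)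
    {g : Plane → ℝ≥0∞} (hg : Measurable g) {A : Set Plane} (hA : MeasurableSet A) (t : ℝ≥0∞) :
    ∫⁻ ω, nexp (shot X g ω) * (1 - nexp (t * count X A ω)) ∂P =
      nexp (ENNReal.ofReal lam * ∫⁻ x, (1 - nexp (g x))) *
        (1 - nexp (ENNReal.ofReal lam * (∫⁻ x in A, nexp (g x)) * (1 - nexp t))) := by
  have hmg : Measurable fun x => nexp (g x) := measurable_nexp.comp hg
  have hmg' : Measurable fun x => 1 - nexp (g x) := measurable_const.sub hmg
  have hgA : Measurable fun x => t * A.indicator (1 : Plane → ℝ≥0∞) x :=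
    (measurable_one.indicator hA).const_mul t
  have hsum : ∀ ω, nexp (shot X g ω) * nexp (t * count X A ω) =
      nexp (shot X (fun x => g x + t * A.indicator (1 : Plane → ℝ≥0∞) x) ω) := by
    intro ω
    rw [shot_add, shot_const_mul, nexp_add, coe_count_eq_shot]
  have h1 : ∀ ω, nexp (shot X g ω) * (1 - nexp (t * count X A ω)) = nexp (shot X g ω) -
      nexp (shot X (fun x => g x + t * A.indicator (1 : Plane → ℝ≥0∞) x) ω) := by
    intro ω
    rw [← hsum, ENNReal.mul_sub fun _ _ => nexp_ne_top _, mul_one]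
  have h2 : ∫⁻ x, (1 - nexp (g x + t * A.indicator (1 : Plane → ℝ≥0∞) x)) =
      (∫⁻ x, (1 - nexp (g x))) + (∫⁻ x in A, nexp (g x)) * (1 - nexp t) := by
    rw [← lintegral_mul_const _ hmg, ← lintegral_indicator hA,
      ← lintegral_add_left hmg']
    refine lintegral_congr fun x => ?_
    by_cases hx : x ∈ A
    · simp only [Set.indicator_of_mem hx, Pi.one_apply, mul_one, nexp_add]
      rw [ENNReal.mul_sub fun _ _ => nexp_ne_top _, mul_one, tsub_add_tsub_cancel (nexp_le_one _)]
      exact mul_le_of_le_one_right zero_le (nexp_le_one _)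
    · simp [Set.indicator_of_notMem hx]
  have h3 : Measurable fun x => g x + t * A.indicator (1 : Plane → ℝ≥0∞) x := hg.add hgA
  have h4 : Measurable fun ω =>
      nexp (shot X (fun x => g x + t * A.indicator (1 : Plane → ℝ≥0∞) x) ω) :=
    measurable_nexp.comp (measurable_shot hX.measurable h3)
  simp_rw [h1]
  rw [lintegral_sub h4, hX.lintegral_nexp_shot hg, hX.lintegral_nexp_shot h3, h2, mul_add, nexp_add,
    ENNReal.mul_sub fun _ _ => nexp_ne_top _, mul_one, mul_assoc]
  · rw [hX.lintegral_nexp_shot h3]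
    exact nexp_ne_top _
  · refine Eventually.of_forall fun ω => antitone_nexp ?_
    rw [shot_add]
    exact le_self_add

lemma lintegral_count_le (hX : IsHomogeneousPoissonProcess P lam X) {A : Set Plane}
    (hA : MeasurableSet A) (hA' : volume A ≠ ∞) :
    ∫⁻ ω, count X A ω ∂P ≤ ENNReal.ofReal lam * volume A := by
  have hm : Measurable fun ω => (count X A ω : ℝ≥0∞) :=
    (Measurable.of_discrete (f := fun n : ℕ∞ => (n : ℝ≥0∞))).comp
      (measurable_count hX.measurable hA)
  have h1 : ∀ᵐ ω ∂P, (count X A ω : ℝ≥0∞) = liminf (fun n : ℕ => ((n : ℝ≥0∞) + 1) *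
      (1 - nexp (((n : ℝ≥0∞) + 1)⁻¹ * count X A ω))) atTop := by
    filter_upwards [hX.ae_count_ne_top hA hA'] with ω hω
    exact (tendsto_succ_mul_one_sub_nexp (by simpa using hω)).liminf_eq.symm
  rw [lintegral_congr_ae h1]
  refine (lintegral_liminf_le fun n => by fun_prop).trans ?_
  have h2 := fun n : ℕ => hX.lintegral_nexp_shot_mul_one_sub (g := fun _ => 0) measurable_const hA
    ((n : ℝ≥0∞) + 1)⁻¹
  simp only [shot, tsum_zero, nexp_zero, one_mul, tsub_self, lintegral_zero, mul_zero,
    setLIntegral_one] at h2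
  have h3 : ∀ n : ℕ, ∫⁻ ω, ((n : ℝ≥0∞) + 1) *
      (1 - nexp (((n : ℝ≥0∞) + 1)⁻¹ * count X A ω)) ∂P = ((n : ℝ≥0∞) + 1) *
      (1 - nexp (ENNReal.ofReal lam * volume A * (1 - nexp ((n : ℝ≥0∞) + 1)⁻¹))) := by
    intro n
    rw [lintegral_const_mul _ (by fun_prop), h2]
  simp_rw [h3]
  exact (tendsto_succ_mul_one_sub_nexp_mul_one_sub_nexp
    (ENNReal.mul_ne_top ENNReal.ofReal_ne_top hA')).liminf_eq.le

lemma lintegral_count_mul_nexp_shot (hX : IsHomogeneousPoissonProcess P lam X)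
    {g : Plane → ℝ≥0∞} (hg : Measurable g) {A : Set Plane} (hA : MeasurableSet A)
    (hA' : volume A ≠ ∞) :
    ∫⁻ ω, nexp (shot X g ω) * count X A ω ∂P =
      nexp (ENNReal.ofReal lam * ∫⁻ x, (1 - nexp (g x))) *
        (ENNReal.ofReal lam * ∫⁻ x in A, nexp (g x)) := by
  have hm : Measurable fun ω => (count X A ω : ℝ≥0∞) :=
    (Measurable.of_discrete (f := fun n : ℕ∞ => (n : ℝ≥0∞))).comp
      (measurable_count hX.measurable hA)
  have hms := measurable_nexp.comp (measurable_shot hX.measurable hg)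
  have hfin : ENNReal.ofReal lam * ∫⁻ x in A, nexp (g x) ≠ ∞ := by
    refine ENNReal.mul_ne_top ENNReal.ofReal_ne_top (ne_top_of_le_ne_top hA' ?_)
    calc ∫⁻ x in A, nexp (g x) ≤ ∫⁻ x in A, 1 := lintegral_mono fun x => nexp_le_one _
      _ = volume A := setLIntegral_one A
  have hR := ENNReal.Tendsto.const_mul (tendsto_succ_mul_one_sub_nexp_mul_one_sub_nexp hfin)
    (Or.inr (nexp_ne_top (ENNReal.ofReal lam * ∫⁻ x, (1 - nexp (g x)))))
  refine tendsto_nhds_unique ?_ hR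
  have h1 : ∀ n : ℕ, nexp (ENNReal.ofReal lam * ∫⁻ x, (1 - nexp (g x))) * (((n : ℝ≥0∞) + 1) *
      (1 - nexp (ENNReal.ofReal lam * (∫⁻ x in A, nexp (g x)) * (1 - nexp ((n : ℝ≥0∞) + 1)⁻¹)))) =
      ∫⁻ ω, nexp (shot X g ω) *
        (((n : ℝ≥0∞) + 1) * (1 - nexp (((n : ℝ≥0∞) + 1)⁻¹ * count X A ω))) ∂P := by
    intro n
    rw [mul_left_comm, ← hX.lintegral_nexp_shot_mul_one_sub hg hA,
      ← lintegral_const_mul _ (by fun_prop)]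
    exact lintegral_congr fun ω => mul_left_comm _ _ _
  simp_rw [h1]
  refine tendsto_lintegral_of_dominated_convergence (fun ω => count X A ω)
    (fun n => by fun_prop) (fun n => Eventually.of_forall fun ω => ?_)
    (ne_top_of_le_ne_top (ENNReal.mul_ne_top ENNReal.ofReal_ne_top hA')
      (hX.lintegral_count_le hA hA')) ?_
  · exact (mul_le_of_le_one_left zero_le (nexp_le_one _)).trans (succ_mul_one_sub_nexp_le n _)
  · filter_upwards [hX.ae_count_ne_top hA hA'] with ω hω
    exact ENNReal.Tendsto.const_mul (tendsto_succ_mul_one_sub_nexp (by simpa using hω))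
      (Or.inr (nexp_ne_top _))

lemma lintegral_tsum_mul_nexp_shot (hX : IsHomogeneousPoissonProcess P lam X)
    {f g : Plane → ℝ≥0∞} (hf : Measurable f) (hg : Measurable g) :
    ∑' k, ∫⁻ ω, f (X k ω) * nexp (shot X g ω) ∂P =
      ENNReal.ofReal lam * (∫⁻ x, f x * nexp (g x)) *
        nexp (ENNReal.ofReal lam * ∫⁻ x, (1 - nexp (g x))) := by
  have hms : Measurable fun ω => nexp (shot X g ω) :=
    measurable_nexp.comp (measurable_shot hX.measurable hg)
  have hmg : Measurable fun x => nexp (g x) := measurable_nexp.comp hg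
  set μ : Measure Plane := Measure.sum fun k =>
    (P.withDensity fun ω => nexp (shot X g ω)).map (X k) with hμ
  set ν : Measure Plane := (nexp (ENNReal.ofReal lam * ∫⁻ x, (1 - nexp (g x))) *
    ENNReal.ofReal lam) • volume.withDensity fun x => nexp (g x) with hν
  have hμA : ∀ A, MeasurableSet A → μ A = ∫⁻ ω, nexp (shot X g ω) * count X A ω ∂P := by
    intro A hA
    have : ∀ ω, nexp (shot X g ω) * count X A ω =
        ∑' k, (X k ⁻¹' A).indicator (fun ω => nexp (shot X g ω)) ω := by
      intro ω
      rw [coe_count_eq_shot, shot.eq_def X (A.indicator 1), ← ENNReal.tsum_mul_left]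
      refine tsum_congr fun k => ?_
      by_cases h : X k ω ∈ A
      · rw [Set.indicator_of_mem h, Set.indicator_of_mem (Set.mem_preimage.2 h)]; simp
      · rw [Set.indicator_of_notMem h, Set.indicator_of_notMem (by simpa using h), mul_zero]
    simp_rw [this]
    rw [lintegral_tsum fun k => (hms.indicator (hX.measurable k hA)).aemeasurable, hμ,
      Measure.sum_apply _ hA]
    refine tsum_congr fun k => ?_
    rw [Measure.map_apply (hX.measurable k) hA, withDensity_apply _ (hX.measurable k hA),
      lintegral_indicator (hX.measurable k hA)]
  have hμν : μ = ν := by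
    ext A hA
    have hU : A = ⋃ n : ℕ, A ∩ Metric.closedBall 0 n := by
      rw [← Set.inter_iUnion, Metric.iUnion_closedBall_nat, Set.inter_univ]
    have hmon : Monotone fun n : ℕ => A ∩ Metric.closedBall (0 : Plane) n := fun m n hmn =>
      Set.inter_subset_inter_right _
        (Metric.closedBall_subset_closedBall (by exact_mod_cast hmn))
    rw [hU, hmon.measure_iUnion, hmon.measure_iUnion]
    refine iSup_congr fun n => ?_
    have hAn : MeasurableSet (A ∩ Metric.closedBall (0 : Plane) n) :=
      hA.inter Metric.isClosed_closedBall.measurableSet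
    rw [hμA _ hAn, hX.lintegral_count_mul_nexp_shot hg hAn, hν, Measure.smul_apply,
      withDensity_apply _ hAn, smul_eq_mul, mul_assoc]
    exact ((measure_mono Set.inter_subset_right).trans_lt measure_closedBall_lt_top).ne
  have h1 : ∫⁻ x, f x ∂μ = ∑' k, ∫⁻ ω, f (X k ω) * nexp (shot X g ω) ∂P := by
    rw [hμ, lintegral_sum_measure]
    refine tsum_congr fun k => ?_
    have hfX : Measurable fun ω => f (X k ω) := hf.comp (hX.measurable k)
    rw [lintegral_map hf (hX.measurable k), lintegral_withDensity_eq_lintegral_mul _ hms hfX]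
    exact lintegral_congr fun ω => mul_comm _ _
  rw [← h1, hμν, hν, lintegral_smul_measure, lintegral_withDensity_eq_lintegral_mul _ hmg hf,
    smul_eq_mul, mul_assoc, mul_comm]
  congr 2
  exact lintegral_congr fun ω => mul_comm _ _

/-- Campbell's formula. -/
lemma lintegral_tsum (hX : IsHomogeneousPoissonProcess P lam X) {f : Plane → ℝ≥0∞}
    (hf : Measurable f) :
    ∑' k, ∫⁻ ω, f (X k ω) ∂P = ENNReal.ofReal lam * ∫⁻ x, f x := by
  simpa [shot] using hX.lintegral_tsum_mul_nexp_shot hf (g := fun _ => 0) measurable_const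

/-- The Mecke equation for an exponential functional of the other points. -/
theorem lintegral_tsum_mul_nexp_tsum_ne (hX : IsHomogeneousPoissonProcess P lam X)
    {φ g : Plane → ℝ≥0∞} (hφ : Measurable φ) (hφ' : ∫⁻ x, φ x ≠ ∞) (hg : Measurable g) :
    ∫⁻ ω, ∑' k, φ (X k ω) * nexp (∑' l : {l // l ≠ k}, g (X l ω)) ∂P =
      ENNReal.ofReal lam * (∫⁻ x, φ x) *
        nexp (ENNReal.ofReal lam * ∫⁻ x, (1 - nexp (g x))) := by
  have hmeas : ∀ g : Plane → ℝ≥0∞, Measurable g → ∀ k, Measurable fun ω =>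
      φ (X k ω) * nexp (∑' l : {l // l ≠ k}, g (X l ω)) := fun g hg k =>
    (hφ.comp (hX.measurable k)).mul (measurable_nexp.comp
      (Measurable.tsum fun l => hg.comp (hX.measurable l)))
  have hfinite : ∀ g : Plane → ℝ≥0∞, Measurable g → (∀ x, g x ≠ ∞) →
      ∫⁻ ω, ∑' k, φ (X k ω) * nexp (∑' l : {l // l ≠ k}, g (X l ω)) ∂P =
      ENNReal.ofReal lam * (∫⁻ x, φ x) *
        nexp (ENNReal.ofReal lam * ∫⁻ x, (1 - nexp (g x))) := by
    intro g hg hgt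
    have h0 : ∀ x, nexp (g x) ≠ 0 := fun x => by
      rw [nexp_of_ne_top (hgt x)]; simpa using Real.exp_pos _
    rw [MeasureTheory.lintegral_tsum fun k => (hmeas g hg k).aemeasurable]
    have h1 := hX.lintegral_tsum_mul_nexp_shot (f := fun x => φ x * (nexp (g x))⁻¹)
      (hφ.mul (measurable_nexp.comp hg).inv) hg
    have h2 : ∀ x, φ x * (nexp (g x))⁻¹ * nexp (g x) = φ x := fun x => by
      rw [mul_assoc, ENNReal.inv_mul_cancel (h0 x) (nexp_ne_top _), mul_one]
    simp_rw [h2] at h1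
    rw [← h1]
    refine tsum_congr fun k => lintegral_congr fun ω => ?_
    rw [shot, tsum_eq_add_tsum_ne _ k, nexp_add, ← mul_assoc, h2]
  have hmono : ∀ x, Monotone fun n : ℕ => min (g x) n := fun x m n hmn =>
    min_le_min_left _ (by exact_mod_cast hmn)
  have hlim : ∀ x, Tendsto (fun n : ℕ => min (g x) n) atTop (𝓝 (g x)) := fun x => by
    simpa using tendsto_const_nhds.min ENNReal.tendsto_nat_nhds_top
  have hL : Tendsto (fun n : ℕ => ∫⁻ ω, ∑' k, φ (X k ω) *
      nexp (∑' l : {l // l ≠ k}, min (g (X l ω)) n) ∂P) atTop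
      (𝓝 (∫⁻ ω, ∑' k, φ (X k ω) * nexp (∑' l : {l // l ≠ k}, g (X l ω)) ∂P)) := by
    have hbound : ∫⁻ ω, ∑' k, φ (X k ω) ∂P ≠ ∞ := by
      have hφX : ∀ k, AEMeasurable (fun ω => φ (X k ω)) P :=
        fun k => (hφ.comp (hX.measurable k)).aemeasurable
      rw [MeasureTheory.lintegral_tsum hφX, hX.lintegral_tsum hφ]
      exact ENNReal.mul_ne_top ENNReal.ofReal_ne_top hφ'
    refine tendsto_lintegral_of_dominated_convergence (fun ω => ∑' k, φ (X k ω))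
      (fun n => Measurable.tsum fun k => hmeas _ (hg.min measurable_const) k)
      (fun n => Eventually.of_forall fun ω => ENNReal.tsum_le_tsum fun k =>
        mul_le_of_le_one_right zero_le (nexp_le_one _)) hbound ?_
    filter_upwards [ae_lt_top (Measurable.tsum fun k => hφ.comp (hX.measurable k)) hbound]
      with ω hω
    simp_rw [← lintegral_count (fun k => φ (X k ω) * _)]
    refine tendsto_lintegral_of_dominated_convergence (fun k => φ (X k ω))
      (fun n => Measurable.of_discrete)
      (fun n => Eventually.of_forall fun k => mul_le_of_le_one_right zero_le (nexp_le_one _))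
      (by rw [lintegral_count]; exact hω.ne) (Eventually.of_forall fun k => ?_)
    refine ENNReal.Tendsto.const_mul ((continuous_nexp.tendsto _).comp ?_)
      (Or.inr (ne_top_of_le_ne_top hω.ne (ENNReal.le_tsum k)))
    simp_rw [← lintegral_count (fun l : {l // l ≠ k} => _)]
    exact lintegral_tendsto_of_tendsto_of_monotone (fun n => Measurable.of_discrete.aemeasurable)
      (Eventually.of_forall fun l => hmono _) (Eventually.of_forall fun l => hlim _)
  have hR : Tendsto (fun n : ℕ => ENNReal.ofReal lam * (∫⁻ x, φ x) *
      nexp (ENNReal.ofReal lam * ∫⁻ x, (1 - nexp (min (g x) n)))) atTop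
      (𝓝 (ENNReal.ofReal lam * (∫⁻ x, φ x) *
        nexp (ENNReal.ofReal lam * ∫⁻ x, (1 - nexp (g x))))) := by
    refine ENNReal.Tendsto.const_mul ((continuous_nexp.tendsto _).comp
      (ENNReal.Tendsto.const_mul ?_ (Or.inr ENNReal.ofReal_ne_top)))
      (Or.inr (ENNReal.mul_ne_top ENNReal.ofReal_ne_top hφ'))
    refine lintegral_tendsto_of_tendsto_of_monotone
      (fun n => (measurable_const.sub (measurable_nexp.comp
        (hg.min measurable_const))).aemeasurable)
      (Eventually.of_forall fun x m n hmn => tsub_le_tsub_left (antitone_nexp (hmono x hmn)) _)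
      (Eventually.of_forall fun x => ?_)
    exact ENNReal.Tendsto.sub tendsto_const_nhds ((continuous_nexp.tendsto _).comp (hlim x))
      (Or.inl ENNReal.one_ne_top)
  refine tendsto_nhds_unique hL (hR.congr fun n => ?_)
  exact (hfinite _ (hg.min measurable_const)
    fun x => ne_top_of_le_ne_top (ENNReal.natCast_ne_top n) (min_le_right _ _)).symm

end IsHomogeneousPoissonProcess
end Poisson

section Poisson

variable {Ω : Type*} [MeasurableSpace Ω]

/-- The plane is the disjoint union of countably many measurable sets of small diameter. -/
lemma exists_partition_plane {δ : ℝ} (hδ : 0 < δ) :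
    ∃ (A : ℕ → Set Plane) (a : ℕ → Plane), (∀ j, MeasurableSet (A j)) ∧
      Pairwise (Function.onFun Disjoint A) ∧ (⋃ j, A j) = Set.univ ∧
      ∀ j, ∀ x ∈ A j, dist x (a j) ≤ δ := by
  refine ⟨disjointed fun j => Metric.ball (TopologicalSpace.denseSeq Plane j) δ,
    TopologicalSpace.denseSeq Plane, ?_, disjoint_disjointed _, ?_, ?_⟩
  · exact fun j => MeasurableSet.disjointed (fun _ => Metric.isOpen_ball.measurableSet) j
  · rw [iUnion_disjointed, Set.eq_univ_iff_forall]
    intro x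
    obtain ⟨j, hj⟩ := (TopologicalSpace.denseRange_denseSeq Plane).exists_dist_lt x hδ
    exact Set.mem_iUnion.2 ⟨j, Metric.mem_ball.2 hj⟩
  · exact fun j x hx => (Metric.mem_ball.1 (disjointed_subset (fun j => Metric.ball
      (TopologicalSpace.denseSeq Plane j) δ) j hx)).le

namespace IsHomogeneousPoissonProcess

variable {P : Measure Ω} [IsProbabilityMeasure P] {lam : ℝ} {X : ℕ → Ω → Plane}

lemma lintegral_tsum_partition (hX : IsHomogeneousPoissonProcess P lam X)
    {φ : Plane → ℝ≥0∞} (hφ : Measurable φ) (hφ' : ∫⁻ x, φ x ≠ ∞) {η : ℝ → ℝ≥0∞}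
    (hη : Measurable η) (v : Plane) {A : ℕ → Set Plane} (a : ℕ → Plane)
    (hA : ∀ j, MeasurableSet (A j)) (hAd : Pairwise (Function.onFun Disjoint A))
    (hAU : (⋃ j, A j) = Set.univ) :
    ∑' j, ∫⁻ ω, ∑' k, (A j).indicator φ (X k ω + v) *
        nexp (∑' l : {l // l ≠ k}, η (dist (X l ω) (a j))) ∂P =
      ENNReal.ofReal lam * (∫⁻ x, φ x) *
        nexp (ENNReal.ofReal lam * ∫⁻ u : Plane, (1 - nexp (η ‖u‖))) := by
  have h1 : ∀ j, ∫⁻ x, (A j).indicator φ (x + v) = ∫⁻ x in A j, φ x := fun j => by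
    rw [lintegral_add_right_eq_self ((A j).indicator φ), lintegral_indicator (hA j)]
  have h2 : ∀ j, ∫⁻ x, (1 - nexp (η (dist x (a j)))) = ∫⁻ u : Plane, (1 - nexp (η ‖u‖)) :=
    fun j => by
      simp_rw [dist_eq_norm]
      exact lintegral_sub_right_eq_self (fun u : Plane => 1 - nexp (η ‖u‖)) (a j)
  have h3 : ∀ j, ∫⁻ ω, ∑' k, (A j).indicator φ (X k ω + v) *
        nexp (∑' l : {l // l ≠ k}, η (dist (X l ω) (a j))) ∂P =
      ENNReal.ofReal lam * (∫⁻ x in A j, φ x) *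
        nexp (ENNReal.ofReal lam * ∫⁻ u : Plane, (1 - nexp (η ‖u‖))) := by
    intro j
    rw [← h1, ← h2 j]
    refine hX.lintegral_tsum_mul_nexp_tsum_ne (φ := fun x => (A j).indicator φ (x + v))
      (g := fun x => η (dist x (a j)))
      ((hφ.indicator (hA j)).comp (measurable_add_const v)) ?_ (hη.comp (by fun_prop))
    rw [h1]
    exact ne_top_of_le_ne_top hφ' (setLIntegral_le_lintegral _ _)
  simp_rw [h3]
  rw [ENNReal.tsum_mul_right, ENNReal.tsum_mul_left, ← lintegral_iUnion hA hAd, hAU,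
    Measure.restrict_univ]

/-- The Mecke equation for an exponential functional of the distances of the other points from a
displaced point. -/
theorem lintegral_tsum_mul_nexp_tsum_dist (hX : IsHomogeneousPoissonProcess P lam X)
    {φ : Plane → ℝ≥0∞} (hφ : Measurable φ) (hφ' : ∫⁻ x, φ x ≠ ∞) {g : ℝ → ℝ≥0∞}
    (hg : Antitone g) (hgc : Continuous fun r => nexp (g r))
    (hfin : ∫⁻ u : Plane, (1 - nexp (g (‖u‖ - 1))) ≠ ∞) (v : Plane) :
    ∫⁻ ω, ∑' k, φ (X k ω + v) *
        nexp (∑' l : {l // l ≠ k}, g (dist (X l ω) (X k ω + v))) ∂P =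
      ENNReal.ofReal lam * (∫⁻ x, φ x) *
        nexp (ENNReal.ofReal lam * ∫⁻ u : Plane, (1 - nexp (g ‖u‖))) := by
  have hgm : Measurable g := hg.measurable
  have hmeas : ∀ k, Measurable fun ω => φ (X k ω + v) *
      nexp (∑' l : {l // l ≠ k}, g (dist (X l ω) (X k ω + v))) := by
    intro k
    have := hX.measurable
    refine (hφ.comp (by fun_prop)).mul (measurable_nexp.comp (Measurable.tsum fun l => ?_))
    exact hgm.comp (by fun_prop)
  set L := ∫⁻ ω, ∑' k, φ (X k ω + v) *
    nexp (∑' l : {l // l ≠ k}, g (dist (X l ω) (X k ω + v))) ∂P with hL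
  set I : ℝ → ℝ≥0∞ := fun e => ENNReal.ofReal lam * (∫⁻ x, φ x) *
    nexp (ENNReal.ofReal lam * ∫⁻ u : Plane, (1 - nexp (g (‖u‖ + e)))) with hI
  have hIlim : Tendsto I (𝓝 0) (𝓝 (I 0)) := by
    refine ENNReal.Tendsto.const_mul ((continuous_nexp.tendsto _).comp
      (ENNReal.Tendsto.const_mul ?_ (Or.inr ENNReal.ofReal_ne_top)))
      (Or.inr (ENNReal.mul_ne_top ENNReal.ofReal_ne_top hφ'))
    refine tendsto_lintegral_filter_of_dominated_convergence
      (fun u : Plane => 1 - nexp (g (‖u‖ - 1))) (Eventually.of_forall fun e => ?_) ?_ hfin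
      (Eventually.of_forall fun u => ?_)
    · exact (measurable_const.sub (measurable_nexp.comp (hgm.comp (by fun_prop))))
    · filter_upwards [eventually_ge_nhds (show (-1 : ℝ) < 0 by norm_num)] with e he
      refine Eventually.of_forall fun u => tsub_le_tsub_left (antitone_nexp (hg ?_)) _
      linarith
    · refine ENNReal.Tendsto.sub tendsto_const_nhds ?_ (Or.inl ENNReal.one_ne_top)
      exact (hgc.comp (continuous_const.add continuous_id)).tendsto 0
  have hcell : ∀ δ > 0, L ≤ I δ ∧ I (-δ) ≤ L := by
    intro δ hδ
    obtain ⟨A, a, hA, hAd, hAU, hAa⟩ := exists_partition_plane hδ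
    have hsplit : L = ∑' j, ∫⁻ ω, ∑' k, (A j).indicator φ (X k ω + v) *
        nexp (∑' l : {l // l ≠ k}, g (dist (X l ω) (X k ω + v))) ∂P := by
      rw [← MeasureTheory.lintegral_tsum]
      · refine lintegral_congr fun ω => ?_
        rw [ENNReal.tsum_comm]
        refine tsum_congr fun k => ?_
        rw [ENNReal.tsum_mul_right]
        congr 1
        obtain ⟨j, hj⟩ := Set.mem_iUnion.1 (hAU ▸ Set.mem_univ (X k ω + v))
        rw [tsum_eq_single j fun i hi => Set.indicator_of_notMem
          (fun h => Set.disjoint_left.1 (hAd hi) h hj) _, Set.indicator_of_mem hj]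
      · intro j
        refine (Measurable.tsum fun k => ?_).aemeasurable
        have := hX.measurable
        refine ((hφ.indicator (hA j)).comp (by fun_prop)).mul
          (measurable_nexp.comp (Measurable.tsum fun l => ?_))
        exact hgm.comp (by fun_prop)
    constructor
    · rw [hsplit, hI]
      simp only
      rw [← hX.lintegral_tsum_partition hφ hφ' (η := fun r => g (r + δ))
        (hgm.comp (measurable_add_const δ)) v a hA hAd hAU]
      refine ENNReal.tsum_le_tsum fun j => lintegral_mono fun ω => ENNReal.tsum_le_tsum fun k => ?_
      by_cases h : X k ω + v ∈ A j
      · refine mul_le_mul_right (antitone_nexp (ENNReal.tsum_le_tsum fun l => hg ?_)) _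
        linarith [dist_triangle_right (X l ω) (X k ω + v) (a j), hAa j _ h,
          dist_triangle (X l ω) (a j) (X k ω + v), dist_comm (a j) (X k ω + v)]
      · simp [Set.indicator_of_notMem h]
    · rw [hsplit, hI]
      simp only
      rw [← hX.lintegral_tsum_partition hφ hφ' (η := fun r => g (r + -δ))
        (hgm.comp (measurable_add_const (-δ))) v a hA hAd hAU]
      refine ENNReal.tsum_le_tsum fun j => lintegral_mono fun ω => ENNReal.tsum_le_tsum fun k => ?_
      by_cases h : X k ω + v ∈ A j
      · refine mul_le_mul_right (antitone_nexp (ENNReal.tsum_le_tsum fun l => hg ?_)) _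
        linarith [dist_triangle (X l ω) (X k ω + v) (a j), hAa j _ h]
      · simp [Set.indicator_of_notMem h]
  have hI0 : I 0 = ENNReal.ofReal lam * (∫⁻ x, φ x) *
      nexp (ENNReal.ofReal lam * ∫⁻ u : Plane, (1 - nexp (g ‖u‖))) := by simp [hI]
  rw [← hI0]
  have hseq : Tendsto (fun n : ℕ => 1 / ((n : ℝ) + 1)) atTop (𝓝 0) :=
    tendsto_one_div_add_atTop_nhds_zero_nat
  have hpos : ∀ n : ℕ, 0 < 1 / ((n : ℝ) + 1) := fun n => by positivity
  refine le_antisymm (ge_of_tendsto' (hIlim.comp hseq) fun n => (hcell _ (hpos n)).1)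
    (le_of_tendsto' (hIlim.comp (by simpa using hseq.neg)) fun n => (hcell _ (hpos n)).2)

end IsHomogeneousPoissonProcess
end Poisson

/-- The Laplace transform at `s` of the power received from a D2D transmitter at distance `r`. -/
def interferenceFactor (α : ℝ) (Fp : Measure ℝ) (s : ℝ≥0∞) (r : ℝ) : ℝ≥0∞ :=
  ∫⁻ x, nexp (s * Network.rxPower α x.1 x.2 r) ∂(Fp.prod complexGaussian)

@[fun_prop]
lemma measurable_rxPower {α : ℝ} {γ : Type*} [MeasurableSpace γ] {q : γ → ℝ} {h : γ → ℂ}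
    {r : γ → ℝ} (hq : Measurable q) (hh : Measurable h) (hr : Measurable r) :
    Measurable fun x => Network.rxPower α (q x) (h x) (r x) := by
  unfold Network.rxPower
  fun_prop

lemma continuous_rxPower {α : ℝ} (q : ℝ) (h : ℂ) :
    Continuous fun r => Network.rxPower α q h r := by
  unfold Network.rxPower
  exact (ENNReal.continuous_const_mul (by finiteness)).comp
    (ENNReal.continuous_rpow_const.comp ENNReal.continuous_ofReal)

lemma antitone_rxPower {α : ℝ} (hα : 0 ≤ α) (q : ℝ) (h : ℂ) :
    Antitone fun r => Network.rxPower α q h r := by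
  intro r r' hr
  simp only [Network.rxPower, ENNReal.rpow_neg]
  gcongr

lemma monotone_interferenceFactor {α : ℝ} {Fp : Measure ℝ} (hα : 0 ≤ α) (s : ℝ≥0∞) :
    Monotone (interferenceFactor α Fp s) := fun _ _ hr =>
  lintegral_mono fun _ => antitone_nexp (mul_le_mul_right (antitone_rxPower hα _ _ hr) _)

section Factor

variable {α : ℝ} {Fp : Measure ℝ} [IsProbabilityMeasure Fp]

lemma interferenceFactor_le_one (s : ℝ≥0∞) (r : ℝ) : interferenceFactor α Fp s r ≤ 1 :=
  (lintegral_mono fun _ => nexp_le_one _).trans (by simp)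

lemma measurable_interferenceFactor :
    Measurable fun x : ℝ≥0∞ × ℝ => interferenceFactor α Fp x.1 x.2 := by
  unfold interferenceFactor
  refine Measurable.lintegral_prod_right' (f := fun y : (ℝ≥0∞ × ℝ) × ℝ × ℂ =>
    nexp (y.1.1 * Network.rxPower α y.2.1 y.2.2 y.1.2)) ?_
  fun_prop

lemma continuous_interferenceFactor {s : ℝ≥0∞} (hs : s ≠ ∞) :
    Continuous (interferenceFactor α Fp s) := by
  refine continuous_iff_continuousAt.2 fun r => ?_
  refine tendsto_lintegral_filter_of_dominated_convergence (fun _ => 1)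
    (Eventually.of_forall fun r => by fun_prop)
    (Eventually.of_forall fun r => Eventually.of_forall fun _ => nexp_le_one _) (by simp)
    (Eventually.of_forall fun x => ?_)
  exact (continuous_nexp.comp ((ENNReal.continuous_const_mul hs).comp
    (continuous_rxPower x.1 x.2))).tendsto r

lemma one_sub_interferenceFactor (s : ℝ≥0∞) (r : ℝ) :
    1 - interferenceFactor α Fp s r =
      ∫⁻ x, (1 - nexp (s * Network.rxPower α x.1 x.2 r)) ∂(Fp.prod complexGaussian) := by
  rw [lintegral_sub (by fun_prop) (ne_top_of_le_ne_top ENNReal.one_ne_top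
    (interferenceFactor_le_one s r)) (Eventually.of_forall fun _ => nexp_le_one _)]
  simp [interferenceFactor]

lemma lintegral_one_sub_interferenceFactor (hα : 2 < α) (hFp : ∀ᵐ x ∂Fp, 0 ≤ x)
    (hmom : Integrable (fun x : ℝ => x ^ (2 / α)) Fp) {s : ℝ≥0∞} (hs : s ≠ ∞) :
    ∫⁻ u : Plane, (1 - interferenceFactor α Fp s ‖u‖) =
      ENNReal.ofReal (Real.pi / nsinc (2 / α) * (∫ y, y ^ (2 / α) ∂Fp) * s.toReal ^ (2 / α)) := by
  have hα0 : 0 < α := by linarith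
  have ha : 0 < 2 / α := by positivity
  have ha1 : 2 / α < 1 := (div_lt_one hα0).2 hα
  have hΓ : 0 < Real.Gamma (1 - 2 / α) := Real.Gamma_pos_of_pos (by linarith)
  simp_rw [one_sub_interferenceFactor]
  rw [lintegral_lintegral_swap (by fun_prop)]
  have h1 : ∀ᵐ x ∂(Fp.prod complexGaussian),
      ∫⁻ u : Plane, (1 - nexp (s * Network.rxPower α x.1 x.2 ‖u‖)) =
      ENNReal.ofReal (Real.pi * s.toReal ^ (2 / α) * Real.Gamma (1 - 2 / α)) *
        (ENNReal.ofReal (x.1 ^ (2 / α)) * ENNReal.ofReal ((‖x.2‖ ^ 2) ^ (2 / α))) := by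
    filter_upwards [Measure.quasiMeasurePreserving_fst.ae hFp] with x hx
    have hc : ∀ u : Plane, s * Network.rxPower α x.1 x.2 ‖u‖ =
        ENNReal.ofReal (s.toReal * x.1 * ‖x.2‖ ^ 2) * ENNReal.ofReal ‖u‖ ^ (-α) := by
      intro u
      rw [ENNReal.ofReal_mul (by positivity), ENNReal.ofReal_mul (by positivity),
        ENNReal.ofReal_toReal hs, Network.rxPower]
      ring
    simp_rw [hc]
    rw [lintegral_one_sub_nexp_norm hα (by positivity), ← ENNReal.ofReal_mul (by positivity),
      ← ENNReal.ofReal_mul (by positivity), Real.mul_rpow (by positivity) (by positivity),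
      Real.mul_rpow (by positivity) (by positivity)]
    congr 1; ring
  rw [lintegral_congr_ae h1, lintegral_const_mul' _ _ (by finiteness),
    lintegral_prod_mul (f := fun y : ℝ => ENNReal.ofReal (y ^ (2 / α)))
      (g := fun g : ℂ => ENNReal.ofReal ((‖g‖ ^ 2) ^ (2 / α))) (by fun_prop) (by fun_prop),
    complexGaussian_moment ha,
    ← ofReal_integral_eq_lintegral_ofReal hmom
      (hFp.mono fun x hx => Real.rpow_nonneg hx _)]
  have hE : 0 ≤ ∫ y, y ^ (2 / α) ∂Fp :=
    integral_nonneg_of_ae (hFp.mono fun x hx => Real.rpow_nonneg hx _)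
  rw [← ENNReal.ofReal_mul hE, ← ENNReal.ofReal_mul (by positivity), div_eq_mul_inv Real.pi,
    ← Gamma_mul_Gamma_eq_inv_nsinc ha]
  congr 1; ring

lemma lintegral_one_sub_interferenceFactor_sub_one_ne_top (hα : 2 < α) (hFp : ∀ᵐ x ∂Fp, 0 ≤ x)
    (hmom : Integrable (fun x : ℝ => x ^ (2 / α)) Fp) {s : ℝ≥0∞} (hs : s ≠ ∞) :
    ∫⁻ u : Plane, (1 - interferenceFactor α Fp s (‖u‖ - 1)) ≠ ∞ := by
  have hα0 : 0 < α := by linarith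
  set s' : ℝ≥0∞ := s * ENNReal.ofReal ((1 / 2) ^ (-α)) with hs'
  have hs't : s' ≠ ∞ := ENNReal.mul_ne_top hs ENNReal.ofReal_ne_top
  have hb : ∀ u : Plane, 1 - interferenceFactor α Fp s (‖u‖ - 1) ≤
      (Metric.closedBall (0 : Plane) 2).indicator 1 u +
        (1 - interferenceFactor α Fp s' ‖u‖) := by
    intro u
    by_cases hu : u ∈ Metric.closedBall (0 : Plane) 2
    · rw [Set.indicator_of_mem hu]
      exact tsub_le_self.trans le_self_add
    · rw [Set.indicator_of_notMem hu, zero_add]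
      rw [mem_closedBall_zero_iff, not_le] at hu
      refine tsub_le_tsub_left ?_ _
      have h1 : interferenceFactor α Fp s' ‖u‖ = interferenceFactor α Fp s (1 / 2 * ‖u‖) := by
        unfold interferenceFactor
        refine lintegral_congr fun x => ?_
        rw [hs', Network.rxPower, Network.rxPower, ENNReal.ofReal_mul (p := 1 / 2) (by norm_num),
          ENNReal.mul_rpow_of_ne_top (by finiteness) (by finiteness),
          ENNReal.ofReal_rpow_of_pos (by norm_num : (0 : ℝ) < 1 / 2)]
        congr 1; ring
      rw [h1]
      exact monotone_interferenceFactor hα0.le s (by linarith)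
  refine ne_top_of_le_ne_top ?_ (lintegral_mono hb)
  rw [lintegral_add_left (measurable_one.indicator Metric.isClosed_closedBall.measurableSet),
    lintegral_indicator_one Metric.isClosed_closedBall.measurableSet,
    lintegral_one_sub_interferenceFactor hα hFp hmom hs't]
  exact ENNReal.add_ne_top.2 ⟨measure_closedBall_lt_top.ne, ENNReal.ofReal_ne_top⟩

end Factor

lemma lintegral_comp_prodMk_of_indepFun {Ω γ δ : Type*} [MeasurableSpace Ω] [MeasurableSpace γ]
    [MeasurableSpace δ] {P : Measure Ω} [IsProbabilityMeasure P] {X : Ω → γ} {Y : Ω → δ}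
    (hX : Measurable X) (hY : Measurable Y) (h : IndepFun X Y P) {F : γ × δ → ℝ≥0∞}
    (hF : Measurable F) :
    ∫⁻ ω, F (X ω, Y ω) ∂P = ∫⁻ ω, ∫⁻ y, F (X ω, y) ∂(P.map Y) ∂P := by
  have := Measure.isProbabilityMeasure_map (μ := P) hX.aemeasurable
  have := Measure.isProbabilityMeasure_map (μ := P) hY.aemeasurable
  rw [← lintegral_map (g := fun ω => (X ω, Y ω)) hF (hX.prodMk hY),
    (indepFun_iff_map_prod_eq_prod_map_map hX.aemeasurable hY.aemeasurable).1 h,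
    lintegral_prod _ hF.aemeasurable, lintegral_map hF.lintegral_prod_right' hX]

/-- The position of the receiver relative to its transmitter, for a link with length `m.1` and
direction `m.2.1`. -/
def offset (m : ℝ × ℝ × ℝ) : Plane := m.1 • !₂[Real.cos m.2.1, Real.sin m.2.1]

/-- `p⁻¹ d ^ α` for a link with length `d = m.1` and power `p = m.2.2`. -/
def markZ (α : ℝ) (m : ℝ × ℝ × ℝ) : ℝ≥0∞ :=
  (ENNReal.ofReal m.2.2)⁻¹ * ENNReal.ofReal m.1 ^ α

@[fun_prop]
lemma measurable_offset : Measurable offset := by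
  have : Continuous offset := by unfold offset; fun_prop
  exact this.measurable

@[fun_prop]
lemma measurable_markZ (α : ℝ) : Measurable (markZ α) := by
  unfold markZ
  fun_prop

namespace Network

variable {Ω : Type*}

/-- Length, direction and power of link `k`. -/
def mark (N : Network Ω) (k : ℕ) (ω : Ω) : ℝ × ℝ × ℝ := (N.d k ω, N.dir k ω, N.p k ω)

lemma rx_eq (N : Network Ω) (k : ℕ) (ω : Ω) : N.rx k ω = N.tx k ω + offset (N.mark k ω) := rfl

lemma Z_eq (N : Network Ω) (α : ℝ) (k : ℕ) (ω : Ω) : N.Z α k ω = markZ α (N.mark k ω) := rfl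

section Measurability

variable {mΩ : MeasurableSpace Ω} {N : Network Ω} {k : ℕ}

lemma measurable_mark (hd : Measurable (N.d k)) (hdir : Measurable (N.dir k))
    (hp : Measurable (N.p k)) : Measurable (N.mark k) :=
  hd.prodMk (hdir.prodMk hp)

lemma measurable_rx (htx : Measurable (N.tx k)) (hm : Measurable (N.mark k)) :
    Measurable (N.rx k) :=
  htx.add (measurable_offset.comp hm)

lemma measurable_Z (α : ℝ) (hm : Measurable (N.mark k)) : Measurable (N.Z α k) := by
  rw [funext (N.Z_eq α k)]
  exact (measurable_markZ α).comp hm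

lemma measurable_d2dInterference (α : ℝ) (htx : ∀ l, Measurable (N.tx l))
    (hp : ∀ l ≠ k, Measurable (N.p l)) (hh : ∀ l ≠ k, Measurable (N.h k l))
    (hrx : Measurable (N.rx k)) : Measurable (N.d2dInterference α k) := by
  have h : ∀ l : {l // l ≠ k}, Measurable fun ω =>
      rxPower α (N.p l ω) (N.h k l ω) (dist (N.tx l ω) (N.rx k ω)) := fun l =>
    measurable_rxPower (hp l l.2) (hh l l.2) ((htx l).dist hrx)
  exact Measurable.tsum h

lemma measurable_cellInterference (α : ℝ) (hue : Measurable N.ue) (hp₀ : Measurable N.p₀)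
    (hh₀ : Measurable (N.h₀ k)) (hrx : Measurable (N.rx k)) :
    Measurable (N.cellInterference α k) := by
  unfold cellInterference
  exact measurable_rxPower hp₀ hh₀ (hue.dist hrx)

end Measurability

/-- The σ-algebra generated by a set of sources. -/
@[reducible] def sources (N : Network Ω) (S : Set Source) : MeasurableSpace Ω :=
  ⨆ i ∈ S, N.sigma i

section Sources

variable (N : Network Ω) {S : Set Source}

lemma sources_tx (h : Source.tx ∈ S) : Measurable[N.sources S] fun ω i => N.tx i ω :=
  (comap_measurable _).mono (le_iSup₂ (f := fun i (_ : i ∈ S) => N.sigma i) _ h) le_rfl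

lemma sources_tx_apply (h : Source.tx ∈ S) (l : ℕ) : Measurable[N.sources S] (N.tx l) :=
  (measurable_pi_apply l).comp (N.sources_tx h)

lemma sources_ue (h : Source.ue ∈ S) : Measurable[N.sources S] N.ue :=
  (comap_measurable _).mono (le_iSup₂ (f := fun i (_ : i ∈ S) => N.sigma i) _ h) le_rfl

lemma sources_p₀ (h : Source.p₀ ∈ S) : Measurable[N.sources S] N.p₀ :=
  (comap_measurable _).mono (le_iSup₂ (f := fun i (_ : i ∈ S) => N.sigma i) _ h) le_rfl

lemma sources_d {k : ℕ} (h : Source.d k ∈ S) : Measurable[N.sources S] (N.d k) :=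
  (comap_measurable _).mono (le_iSup₂ (f := fun i (_ : i ∈ S) => N.sigma i) _ h) le_rfl

lemma sources_dir {k : ℕ} (h : Source.dir k ∈ S) : Measurable[N.sources S] (N.dir k) :=
  (comap_measurable _).mono (le_iSup₂ (f := fun i (_ : i ∈ S) => N.sigma i) _ h) le_rfl

lemma sources_p {k : ℕ} (h : Source.p k ∈ S) : Measurable[N.sources S] (N.p k) :=
  (comap_measurable _).mono (le_iSup₂ (f := fun i (_ : i ∈ S) => N.sigma i) _ h) le_rfl

lemma sources_h {k l : ℕ} (h : Source.h k l ∈ S) : Measurable[N.sources S] (N.h k l) :=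
  (comap_measurable _).mono (le_iSup₂ (f := fun i (_ : i ∈ S) => N.sigma i) _ h) le_rfl

lemma sources_h₀ {k : ℕ} (h : Source.h₀ k ∈ S) : Measurable[N.sources S] (N.h₀ k) :=
  (comap_measurable _).mono (le_iSup₂ (f := fun i (_ : i ∈ S) => N.sigma i) _ h) le_rfl

lemma sources_mark {k : ℕ} (hd : Source.d k ∈ S) (hdir : Source.dir k ∈ S)
    (hp : Source.p k ∈ S) : Measurable[N.sources S] (N.mark k) :=
  measurable_mark (N.sources_d hd) (N.sources_dir hdir) (N.sources_p hp)

end Sources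

/-- The law of the length, direction and power of a link. -/
def markLaw (Fp Fd : Measure ℝ) : Measure (ℝ × ℝ × ℝ) :=
  Fd.prod ((ProbabilityTheory.cond volume (Set.Ico 0 (2 * Real.pi))).prod Fp)

/-- The law of the location and power of the uplink user and of its fading towards a receiver. -/
def uplinkLaw (R : ℝ) (Fp₀ : Measure ℝ) : Measure (Plane × ℝ × ℂ) :=
  (ProbabilityTheory.cond volume (Metric.closedBall (0 : Plane) R)).prod (Fp₀.prod complexGaussian)

namespace IsModel

variable [MeasurableSpace Ω] {N : Network Ω} {P : Measure Ω} {lam R : ℝ} {Fp Fp₀ Fd : Measure ℝ}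

lemma measurable_tx (hN : N.IsModel P lam R Fp Fp₀ Fd) (l : ℕ) : Measurable (N.tx l) :=
  hN.poisson.measurable l

lemma measurable_mark (hN : N.IsModel P lam R Fp Fp₀ Fd) (k : ℕ) : Measurable (N.mark k) :=
  Network.measurable_mark (hN.measurable_d k) (hN.measurable_dir k) (hN.measurable_p k)

lemma measurable_rx (hN : N.IsModel P lam R Fp Fp₀ Fd) (k : ℕ) : Measurable (N.rx k) :=
  Network.measurable_rx (hN.measurable_tx k) (hN.measurable_mark k)

lemma measurable_cellInterference (hN : N.IsModel P lam R Fp Fp₀ Fd) (α : ℝ) (k : ℕ) :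
    Measurable (N.cellInterference α k) :=
  Network.measurable_cellInterference α hN.measurable_ue hN.measurable_p₀ (hN.measurable_h₀ k)
    (hN.measurable_rx k)

lemma measurable_sinr (hN : N.IsModel P lam R Fp Fp₀ Fd) (α σ2 : ℝ) (k : ℕ) :
    Measurable (N.sinr α σ2 k) :=
  (measurable_rxPower (hN.measurable_p k) (hN.measurable_h k k) (hN.measurable_d k)).div
    (((Network.measurable_d2dInterference α hN.measurable_tx (fun l _ => hN.measurable_p l)
      (fun l _ => hN.measurable_h k l) (hN.measurable_rx k)).add
      (hN.measurable_cellInterference α k)).add measurable_const)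

lemma sigma_le (hN : N.IsModel P lam R Fp Fp₀ Fd) (i : Source) :
    N.sigma i ≤ ‹MeasurableSpace Ω› := by
  cases i with
  | tx => exact (measurable_pi_lambda _ hN.measurable_tx).comap_le
  | ue => exact hN.measurable_ue.comap_le
  | p₀ => exact hN.measurable_p₀.comap_le
  | d k => exact (hN.measurable_d k).comap_le
  | dir k => exact (hN.measurable_dir k).comap_le
  | p k => exact (hN.measurable_p k).comap_le
  | h k l => exact (hN.measurable_h k l).comap_le
  | h₀ k => exact (hN.measurable_h₀ k).comap_le

lemma sources_le (hN : N.IsModel P lam R Fp Fp₀ Fd) (S : Set Source) :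
    N.sources S ≤ ‹MeasurableSpace Ω› :=
  iSup₂_le fun i _ => hN.sigma_le i

lemma indepFun (hN : N.IsModel P lam R Fp Fp₀ Fd) (T : Set Source) {γ δ : Type*}
    [MeasurableSpace γ] [MeasurableSpace δ] {X : Ω → γ} {Y : Ω → δ}
    (hX : Measurable[N.sources Tᶜ] X) (hY : Measurable[N.sources T] Y) : IndepFun X Y P :=
  indep_of_indep_of_le_left (indep_of_indep_of_le_right
    (indep_iSup_of_disjoint hN.sigma_le hN.indep disjoint_compl_left) hY.comap_le) hX.comap_le

variable [IsProbabilityMeasure P]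

/-- Independent sources can be integrated out. -/
lemma lintegral_comp_prodMk (hN : N.IsModel P lam R Fp Fp₀ Fd) (T : Set Source) {γ δ : Type*}
    [MeasurableSpace γ] [MeasurableSpace δ] {X : Ω → γ} {Y : Ω → δ}
    (hX : Measurable[N.sources Tᶜ] X) (hY : Measurable[N.sources T] Y) {F : γ × δ → ℝ≥0∞}
    (hF : Measurable F) :
    ∫⁻ ω, F (X ω, Y ω) ∂P = ∫⁻ ω, ∫⁻ y, F (X ω, y) ∂(P.map Y) ∂P :=
  lintegral_comp_prodMk_of_indepFun (hX.mono (hN.sources_le _) le_rfl)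
    (hY.mono (hN.sources_le _) le_rfl) (hN.indepFun T hX hY) hF

lemma map_prodMk (hN : N.IsModel P lam R Fp Fp₀ Fd) (T : Set Source) {γ δ : Type*}
    [MeasurableSpace γ] [MeasurableSpace δ] {X : Ω → γ} {Y : Ω → δ}
    (hX : Measurable[N.sources Tᶜ] X) (hY : Measurable[N.sources T] Y) :
    P.map (fun ω => (X ω, Y ω)) = (P.map X).prod (P.map Y) :=
  (indepFun_iff_map_prod_eq_prod_map_map (hX.mono (hN.sources_le _) le_rfl).aemeasurable
    (hY.mono (hN.sources_le _) le_rfl).aemeasurable).1 (hN.indepFun T hX hY)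

lemma isProbabilityMeasure_Fp (hN : N.IsModel P lam R Fp Fp₀ Fd) : IsProbabilityMeasure Fp :=
  hN.law_p 0 ▸ Measure.isProbabilityMeasure_map (hN.measurable_p 0).aemeasurable

lemma isProbabilityMeasure_Fd (hN : N.IsModel P lam R Fp Fp₀ Fd) : IsProbabilityMeasure Fd :=
  hN.law_d 0 ▸ Measure.isProbabilityMeasure_map (hN.measurable_d 0).aemeasurable

lemma isProbabilityMeasure_Fp₀ (hN : N.IsModel P lam R Fp Fp₀ Fd) : IsProbabilityMeasure Fp₀ :=
  hN.law_p₀ ▸ Measure.isProbabilityMeasure_map hN.measurable_p₀.aemeasurable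

lemma map_mark (hN : N.IsModel P lam R Fp Fp₀ Fd) (k : ℕ) :
    P.map (N.mark k) = markLaw Fp Fd := by
  have h1 : P.map (fun ω => (N.dir k ω, N.p k ω)) = (P.map (N.dir k)).prod (P.map (N.p k)) :=
    hN.map_prodMk {Source.p k} (N.sources_dir (by simp)) (N.sources_p (by simp))
  have h2 := hN.map_prodMk {Source.dir k, Source.p k} (N.sources_d (k := k) (by simp))
    ((N.sources_dir (k := k) (by simp)).prodMk (N.sources_p (k := k) (by simp)))
  rw [h1, hN.law_p, hN.law_d, (hN.law_dir k : P.map (N.dir k) = _)] at h2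
  exact h2

lemma map_uplink (hN : N.IsModel P lam R Fp Fp₀ Fd) (k : ℕ) :
    P.map (fun ω => (N.ue ω, N.p₀ ω, N.h₀ k ω)) = uplinkLaw R Fp₀ := by
  have h1 : P.map (fun ω => (N.p₀ ω, N.h₀ k ω)) = (P.map N.p₀).prod (P.map (N.h₀ k)) :=
    hN.map_prodMk {Source.h₀ k} (N.sources_p₀ (by simp)) (N.sources_h₀ (by simp))
  have h2 := hN.map_prodMk {Source.p₀, Source.h₀ k} (N.sources_ue (by simp))
    ((N.sources_p₀ (by simp)).prodMk (N.sources_h₀ (k := k) (by simp)))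
  rw [h1, hN.law_p₀, hN.law_h₀, (hN.law_ue : P.map N.ue = _)] at h2
  exact h2

lemma map_p_h (hN : N.IsModel P lam R Fp Fp₀ Fd) (k l : ℕ) :
    P.map (fun ω => (N.p l ω, N.h k l ω)) = Fp.prod complexGaussian := by
  have h1 := hN.map_prodMk {Source.h k l} (N.sources_p (k := l) (by simp))
    (N.sources_h (k := k) (l := l) (by simp))
  rw [hN.law_p, hN.law_h] at h1
  exact h1

lemma lintegral_prod_p_h (hN : N.IsModel P lam R Fp Fp₀ Fd) (k : ℕ) {ι : Type*} {e : ι → ℕ}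
    (he : Function.Injective e) (s : Finset ι) {f : ι → ℝ × ℂ → ℝ≥0∞} (hf : ∀ i, Measurable (f i)) :
    ∫⁻ ω, ∏ i ∈ s, f i (N.p (e i) ω, N.h k (e i) ω) ∂P =
      ∏ i ∈ s, ∫⁻ x, f i x ∂(Fp.prod complexGaussian) := by
  classical
  induction s using Finset.induction_on with
  | empty => simp
  | insert a s ha ih =>
    simp only [Finset.prod_insert ha]
    set T : Set Source := {Source.p (e a), Source.h k (e a)}
    have hY : Measurable[N.sources T] fun ω => f a (N.p (e a) ω, N.h k (e a) ω) :=
      (hf a).comp ((N.sources_p (by simp [T])).prodMk (N.sources_h (by simp [T])))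
    have hX : Measurable[N.sources Tᶜ] fun ω => ∏ i ∈ s, f i (N.p (e i) ω, N.h k (e i) ω) := by
      refine Finset.measurable_fun_prod _ fun i hi => (hf i).comp ?_
      have hne : e i ≠ e a := fun h => ha (he h ▸ hi)
      exact (N.sources_p (by simp [T, hne])).prodMk (N.sources_h (by simp [T, hne]))
    rw [lintegral_mul_eq_lintegral_mul_lintegral_of_indepFun''
      (hY.mono (hN.sources_le _) le_rfl).aemeasurable
      (hX.mono (hN.sources_le _) le_rfl).aemeasurable (hN.indepFun T hX hY).symm, ih,
      ← hN.map_p_h k (e a), lintegral_map (hf a) ((hN.measurable_p _).prodMk (hN.measurable_h _ _))]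

/-- The Laplace transform of the interference of transmitters at distances `r l`. -/
lemma lintegral_nexp_tsum_rxPower (hN : N.IsModel P lam R Fp Fp₀ Fd) (α : ℝ) (k : ℕ)
    {s : ℝ≥0∞} (hs : s ≠ ∞) (r : {l // l ≠ k} → ℝ) :
    ∫⁻ ω, nexp (s * ∑' l : {l // l ≠ k}, rxPower α (N.p l ω) (N.h k l ω) (r l)) ∂P =
      nexp (∑' l, nlog (interferenceFactor α Fp s (r l))) := by
  have := hN.isProbabilityMeasure_Fp
  have hfin : ∀ F : Finset {l // l ≠ k},
      ∫⁻ ω, nexp (s * ∑ l ∈ F, rxPower α (N.p l ω) (N.h k l ω) (r l)) ∂P =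
        nexp (∑ l ∈ F, nlog (interferenceFactor α Fp s (r l))) := by
    intro F
    simp_rw [Finset.mul_sum, nexp_sum, nexp_nlog (interferenceFactor_le_one s _)]
    exact hN.lintegral_prod_p_h k Subtype.val_injective F
      (f := fun l x => nexp (s * rxPower α x.1 x.2 (r l))) fun l => by fun_prop
  have hsum : ∀ f : {l // l ≠ k} → ℝ≥0∞, Tendsto (fun F => ∑ l ∈ F, f l) atTop (𝓝 (∑' l, f l)) :=
    fun f => ENNReal.summable.hasSum
  have hR := (continuous_nexp.tendsto _).comp
    (hsum fun l => nlog (interferenceFactor α Fp s (r l)))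
  refine tendsto_nhds_unique ?_ (hR.congr fun F => (hfin F).symm)
  have hmr : ∀ l : {l // l ≠ k}, Measurable fun ω => rxPower α (N.p l ω) (N.h k l ω) (r l) :=
    fun l => measurable_rxPower (hN.measurable_p l) (hN.measurable_h k l) measurable_const
  refine tendsto_lintegral_filter_of_dominated_convergence (fun _ => 1)
    (Eventually.of_forall fun F => measurable_nexp.comp
      ((Finset.measurable_fun_sum _ fun l _ => hmr l).const_mul s))
    (Eventually.of_forall fun F => Eventually.of_forall fun ω => nexp_le_one _) (by simp)
    (Eventually.of_forall fun ω => (continuous_nexp.tendsto _).comp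
      (ENNReal.Tendsto.const_mul (hsum _) (Or.inr hs)))

end IsModel
end Network

/-- The probability over the fading of the useful link that the SINR is at least `β`, when `D` is
the total power of interference and noise. -/
lemma complexGaussian_le_rxPower_div {α β : ℝ} (hα : 0 < α) (hβ : 0 < β) {m : ℝ × ℝ × ℝ}
    (hd : 0 < m.1) (hp : 0 ≤ m.2.2) (D : ℝ≥0∞) :
    complexGaussian {g | ENNReal.ofReal β ≤ Network.rxPower α m.2.2 g m.1 / D} =
      if markZ α m = ∞ then 0 else nexp (ENNReal.ofReal β * markZ α m * D) := by
  have hd0 : ENNReal.ofReal m.1 ≠ 0 := by simpa using hd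
  have hdα : ENNReal.ofReal m.1 ^ α ≠ 0 := by simp [hd0, ENNReal.rpow_eq_zero_iff]
  have hdα' : ENNReal.ofReal m.1 ^ α ≠ ∞ := ENNReal.rpow_ne_top_of_nonneg hα.le ENNReal.ofReal_ne_top
  rcases hp.eq_or_lt with hp0 | hp
  · have hz : markZ α m = ∞ := by
      rw [markZ, ← hp0]
      simp [ENNReal.top_mul hdα]
    rw [if_pos hz]
    simp [Network.rxPower, ← hp0, hβ.not_ge]
  · have hp0 : ENNReal.ofReal m.2.2 ≠ 0 := by simpa using hp
    have hz : markZ α m ≠ ∞ := ENNReal.mul_ne_top (by simpa using hp) hdα'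
    rw [if_neg hz, ← complexGaussian_le_norm_sq]
    refine measure_congr ?_
    filter_upwards [ae_complexGaussian_ne_zero] with g hg
    refine propext ?_
    change ENNReal.ofReal β ≤ Network.rxPower α m.2.2 g m.1 / D ↔
      ENNReal.ofReal β * markZ α m * D ≤ ENNReal.ofReal (‖g‖ ^ 2)
    have hc0 : ENNReal.ofReal m.2.2 * ENNReal.ofReal m.1 ^ (-α) ≠ 0 := by
      rw [ENNReal.rpow_neg]
      exact mul_ne_zero hp0 (ENNReal.inv_ne_zero.2 hdα')
    have hct : ENNReal.ofReal m.2.2 * ENNReal.ofReal m.1 ^ (-α) ≠ ∞ := by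
      rw [ENNReal.rpow_neg]
      exact ENNReal.mul_ne_top ENNReal.ofReal_ne_top (ENNReal.inv_ne_top.2 hdα)
    have hrx : Network.rxPower α m.2.2 g m.1 =
        ENNReal.ofReal (‖g‖ ^ 2) * (ENNReal.ofReal m.2.2 * ENNReal.ofReal m.1 ^ (-α)) := by
      rw [Network.rxPower]; ring
    have hzc : markZ α m = (ENNReal.ofReal m.2.2 * ENNReal.ofReal m.1 ^ (-α))⁻¹ := by
      rw [markZ, ENNReal.mul_inv (Or.inl hp0) (Or.inl ENNReal.ofReal_ne_top), ENNReal.rpow_neg,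
        inv_inv]
    have hg0 : ENNReal.ofReal (‖g‖ ^ 2) ≠ 0 := by
      simpa using hg
    rw [hrx, ENNReal.le_div_iff_mul_le (Or.inr (mul_ne_zero hg0 hc0))
      (Or.inr (ENNReal.mul_ne_top ENNReal.ofReal_ne_top hct)),
      ← ENNReal.div_le_iff hc0 hct, div_eq_mul_inv, ← hzc, mul_right_comm]

namespace Network

/-- The Laplace transform at `s` of the power received at `y` from the uplink user. -/
def uplinkFactor (α R : ℝ) (Fp₀ : Measure ℝ) (s : ℝ≥0∞) (y : Plane) : ℝ≥0∞ :=
  ∫⁻ q, nexp (s * rxPower α q.2.1 q.2.2 (dist q.1 y)) ∂(uplinkLaw R Fp₀)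

instance {R : ℝ} {Fp₀ : Measure ℝ} [SFinite Fp₀] : SFinite (uplinkLaw R Fp₀) := by
  unfold uplinkLaw; infer_instance

@[fun_prop]
lemma measurable_uplinkFactor (α R : ℝ) (Fp₀ : Measure ℝ) [SFinite Fp₀] :
    Measurable fun x : ℝ≥0∞ × Plane => uplinkFactor α R Fp₀ x.1 x.2 := by
  unfold uplinkFactor
  refine Measurable.lintegral_prod_right' (f := fun y : (ℝ≥0∞ × Plane) × Plane × ℝ × ℂ =>
    nexp (y.1.1 * rxPower α y.2.2.1 y.2.2.2 (dist y.2.1 y.1.2))) ?_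
  fun_prop

/-- The factor of the coverage probability that is due to noise; it vanishes for silent links. -/
def noiseFactor (β σ2 : ℝ) (z : ℝ≥0∞) : ℝ≥0∞ :=
  if z = ∞ then 0 else nexp (ENNReal.ofReal β * z * ENNReal.ofReal σ2)

@[simp] lemma noiseFactor_top (β σ2 : ℝ) : noiseFactor β σ2 ∞ = 0 := if_pos rfl

lemma noiseFactor_of_ne_top {β σ2 : ℝ} {z : ℝ≥0∞} (hz : z ≠ ∞) :
    noiseFactor β σ2 z = nexp (ENNReal.ofReal β * z * ENNReal.ofReal σ2) := if_neg hz

@[fun_prop]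
lemma measurable_noiseFactor (β σ2 : ℝ) : Measurable (noiseFactor β σ2) :=
  Measurable.ite (measurableSet_singleton _) measurable_const (by fun_prop)

/-- The part of the coverage probability of a link with marks `m` and receiver at `y` which does
not depend on the other links. -/
def linkFactor (α β σ2 R : ℝ) (Fp₀ : Measure ℝ) (m : ℝ × ℝ × ℝ) (y : Plane) : ℝ≥0∞ :=
  (Metric.closedBall (0 : Plane) R).indicator 1 y * (noiseFactor β σ2 (markZ α m) *
    uplinkFactor α R Fp₀ (ENNReal.ofReal β * markZ α m) y)

lemma measurable_indicator_closedBall (R : ℝ) :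
    Measurable ((Metric.closedBall (0 : Plane) R).indicator (1 : Plane → ℝ≥0∞)) :=
  measurable_one.indicator Metric.isClosed_closedBall.measurableSet

@[fun_prop]
lemma measurable_linkFactor (α β σ2 R : ℝ) (Fp₀ : Measure ℝ) [SFinite Fp₀] :
    Measurable fun x : (ℝ × ℝ × ℝ) × Plane => linkFactor α β σ2 R Fp₀ x.1 x.2 := by
  unfold linkFactor
  have h1 := measurable_indicator_closedBall R
  have h2 := (measurable_uplinkFactor α R Fp₀).comp
    (f := fun x : (ℝ × ℝ × ℝ) × Plane => (ENNReal.ofReal β * markZ α x.1, x.2)) (by fun_prop)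
  exact (h1.comp measurable_snd).mul (Measurable.mul (by fun_prop) h2)

namespace IsModel

variable {Ω : Type*} [MeasurableSpace Ω] {N : Network Ω} {P : Measure Ω} {lam R : ℝ}
  {Fp Fp₀ Fd : Measure ℝ}

lemma ae_mark (hN : N.IsModel P lam R Fp Fp₀ Fd) (hFp : ∀ᵐ x ∂Fp, 0 ≤ x)
    (hFd : ∀ᵐ x ∂Fd, 0 < x) (k : ℕ) :
    ∀ᵐ ω ∂P, 0 < (N.mark k ω).1 ∧ 0 ≤ (N.mark k ω).2.2 := by
  rw [← hN.law_p k] at hFp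
  rw [← hN.law_d k] at hFd
  filter_upwards [ae_of_ae_map (hN.measurable_p k).aemeasurable hFp,
    ae_of_ae_map (hN.measurable_d k).aemeasurable hFd] with ω h1 h2
  exact ⟨h2, h1⟩

variable [IsProbabilityMeasure P]

/-- The fading of the useful signal is integrated out. -/
lemma measure_le_sinr_eq_lintegral (hN : N.IsModel P lam R Fp Fp₀ Fd) {α σ2 β : ℝ} (hα : 0 < α)
    (hβ : 0 < β) (hFp : ∀ᵐ x ∂Fp, 0 ≤ x) (hFd : ∀ᵐ x ∂Fd, 0 < x) (k : ℕ) :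
    ∫⁻ ω, (Metric.closedBall (0 : Plane) R).indicator 1 (N.rx k ω) *
        {x | ENNReal.ofReal β ≤ x}.indicator 1 (N.sinr α σ2 k ω) ∂P =
      ∫⁻ ω, (Metric.closedBall (0 : Plane) R).indicator 1 (N.rx k ω) *
        (if N.Z α k ω = ∞ then 0 else nexp (ENNReal.ofReal β * N.Z α k ω *
          (N.d2dInterference α k ω + N.cellInterference α k ω + ENNReal.ofReal σ2))) ∂P := by
  have hC := measurable_indicator_closedBall R
  have hI : Measurable ({x : ℝ≥0∞ | ENNReal.ofReal β ≤ x}.indicator (1 : ℝ≥0∞ → ℝ≥0∞)) :=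
    measurable_one.indicator measurableSet_Ici
  set T : Set Source := {Source.h k k} with hT
  have hm : Measurable[N.sources Tᶜ] (N.mark k) :=
    N.sources_mark (by simp [hT]) (by simp [hT]) (by simp [hT])
  have hrx : Measurable[N.sources Tᶜ] (N.rx k) :=
    Network.measurable_rx (N.sources_tx_apply (by simp [hT]) k) hm
  have hD : Measurable[N.sources Tᶜ] fun ω =>
      N.d2dInterference α k ω + N.cellInterference α k ω + ENNReal.ofReal σ2 :=
    ((Network.measurable_d2dInterference α (N.sources_tx_apply (by simp [hT]))
      (fun l _ => N.sources_p (by simp [hT])) (fun l hl => N.sources_h (by simp [hT, hl])) hrx).add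
      (Network.measurable_cellInterference α (N.sources_ue (by simp [hT]))
        (N.sources_p₀ (by simp [hT])) (N.sources_h₀ (by simp [hT])) hrx)).add measurable_const
  set F : (Plane × (ℝ × ℝ × ℝ) × ℝ≥0∞) × ℂ → ℝ≥0∞ := fun x =>
    (Metric.closedBall (0 : Plane) R).indicator 1 x.1.1 * {x | ENNReal.ofReal β ≤ x}.indicator 1
      (rxPower α x.1.2.1.2.2 x.2 x.1.2.1.1 / x.1.2.2) with hF
  have hFm : Measurable F := by
    refine Measurable.mul (hC.comp (by fun_prop)) (hI.comp ?_)
    exact (measurable_rxPower (by fun_prop) (by fun_prop) (by fun_prop)).div (by fun_prop)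
  have h1 := hN.lintegral_comp_prodMk T (hrx.prodMk (hm.prodMk hD))
    (N.sources_h (k := k) (l := k) (by simp [hT])) hFm
  refine h1.trans (lintegral_congr_ae ?_)
  filter_upwards [hN.ae_mark hFp hFd k] with ω hω
  rw [hN.law_h, Z_eq, ← complexGaussian_le_rxPower_div hα hβ hω.1 hω.2]
  simp only [hF]
  have hS : MeasurableSet {g | ENNReal.ofReal β ≤ rxPower α (N.mark k ω).2.2 g (N.mark k ω).1 /
      (N.d2dInterference α k ω + N.cellInterference α k ω + ENNReal.ofReal σ2)} :=
    measurableSet_le measurable_const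
      ((measurable_rxPower measurable_const measurable_id measurable_const).div measurable_const)
  rw [← lintegral_indicator_one hS, lintegral_const_mul' _ _ (by
    refine ne_top_of_le_ne_top ENNReal.one_ne_top (Set.indicator_le_self' (fun _ _ => ?_) _)
    exact zero_le)]
  rfl

/-- The uplink user is integrated out. -/
lemma lintegral_uplink (hN : N.IsModel P lam R Fp Fp₀ Fd) {α σ2 β : ℝ} (k : ℕ) :
    ∫⁻ ω, (Metric.closedBall (0 : Plane) R).indicator 1 (N.rx k ω) *
        (if N.Z α k ω = ∞ then 0 else nexp (ENNReal.ofReal β * N.Z α k ω *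
          (N.d2dInterference α k ω + N.cellInterference α k ω + ENNReal.ofReal σ2))) ∂P =
      ∫⁻ ω, linkFactor α β σ2 R Fp₀ (N.mark k ω) (N.rx k ω) *
        nexp (ENNReal.ofReal β * N.Z α k ω * N.d2dInterference α k ω) ∂P := by
  have := hN.isProbabilityMeasure_Fp₀
  have hC := measurable_indicator_closedBall R
  set T : Set Source := {Source.ue, Source.p₀, Source.h₀ k} with hT
  have hm : Measurable[N.sources Tᶜ] (N.mark k) :=
    N.sources_mark (by simp [hT]) (by simp [hT]) (by simp [hT])
  have hrx : Measurable[N.sources Tᶜ] (N.rx k) :=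
    Network.measurable_rx (N.sources_tx_apply (by simp [hT]) k) hm
  have hI : Measurable[N.sources Tᶜ] (N.d2dInterference α k) :=
    Network.measurable_d2dInterference α (N.sources_tx_apply (by simp [hT]))
      (fun l _ => N.sources_p (by simp [hT])) (fun l hl => N.sources_h (by simp [hT])) hrx
  set F : ((ℝ × ℝ × ℝ) × Plane × ℝ≥0∞) × Plane × ℝ × ℂ → ℝ≥0∞ := fun x =>
    (Metric.closedBall (0 : Plane) R).indicator 1 x.1.2.1 *
      (noiseFactor β σ2 (markZ α x.1.1) * nexp (ENNReal.ofReal β * markZ α x.1.1 *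
        rxPower α x.2.2.1 x.2.2.2 (dist x.2.1 x.1.2.1))) *
      nexp (ENNReal.ofReal β * markZ α x.1.1 * x.1.2.2) with hF
  have hFm : Measurable F := by
    refine Measurable.mul (Measurable.mul (hC.comp (by fun_prop)) ?_) (by fun_prop)
    exact Measurable.mul (by fun_prop) (by fun_prop)
  have h1 := hN.lintegral_comp_prodMk T (hm.prodMk (hrx.prodMk hI))
    ((N.sources_ue (by simp [hT])).prodMk ((N.sources_p₀ (by simp [hT])).prodMk
      (N.sources_h₀ (k := k) (by simp [hT])))) hFm
  rw [hN.map_uplink] at h1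
  have h2 : ∀ ω, (Metric.closedBall (0 : Plane) R).indicator 1 (N.rx k ω) *
      (if N.Z α k ω = ∞ then 0 else nexp (ENNReal.ofReal β * N.Z α k ω *
        (N.d2dInterference α k ω + N.cellInterference α k ω + ENNReal.ofReal σ2))) =
      F ((N.mark k ω, N.rx k ω, N.d2dInterference α k ω), N.ue ω, N.p₀ ω, N.h₀ k ω) := by
    intro ω
    simp only [hF, ← Z_eq]
    by_cases hz : N.Z α k ω = ∞
    · simp [hz]
    · rw [if_neg hz, noiseFactor_of_ne_top hz, mul_add, mul_add, nexp_add, nexp_add, cellInterference]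
      ring
  simp_rw [h2]
  rw [h1]
  refine lintegral_congr fun ω => ?_
  have hmeas : Measurable fun q : Plane × ℝ × ℂ =>
      nexp (ENNReal.ofReal β * markZ α (N.mark k ω) *
        rxPower α q.2.1 q.2.2 (dist q.1 (N.rx k ω))) := by fun_prop
  simp only [hF]
  rw [lintegral_mul_const _ ((hmeas.const_mul _).const_mul _),
    lintegral_const_mul _ (hmeas.const_mul _), lintegral_const_mul _ hmeas]
  rfl

/-- Powers and fading of the other links are integrated out. -/
lemma lintegral_d2d (hN : N.IsModel P lam R Fp Fp₀ Fd) {α σ2 β : ℝ} (k : ℕ) :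
    ∫⁻ ω, linkFactor α β σ2 R Fp₀ (N.mark k ω) (N.rx k ω) *
        nexp (ENNReal.ofReal β * N.Z α k ω * N.d2dInterference α k ω) ∂P =
      ∫⁻ ω, linkFactor α β σ2 R Fp₀ (N.mark k ω) (N.rx k ω) *
        nexp (∑' l : {l // l ≠ k}, nlog (interferenceFactor α Fp
          (ENNReal.ofReal β * N.Z α k ω) (dist (N.tx l ω) (N.rx k ω)))) ∂P := by
  have := hN.isProbabilityMeasure_Fp₀
  have hlf := measurable_linkFactor α β σ2 R Fp₀
  set T : Set Source := {i | ∃ l ≠ k, i = Source.p l ∨ i = Source.h k l} with hT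
  have hX : Measurable[N.sources Tᶜ] fun ω => (N.mark k ω, fun i => N.tx i ω) :=
    (N.sources_mark (by simp [hT]) (by simp [hT]) (by simp [hT])).prodMk
      (N.sources_tx (by simp [hT]))
  have hY : Measurable[N.sources T] fun ω (l : {l // l ≠ k}) => (N.p l ω, N.h k l ω) :=
    @measurable_pi_lambda _ _ _ (N.sources T) _ _ fun l =>
      (N.sources_p (show Source.p l ∈ T from ⟨l, l.2, Or.inl rfl⟩)).prodMk
        (N.sources_h (show Source.h k l ∈ T from ⟨l, l.2, Or.inr rfl⟩))
  set F : ((ℝ × ℝ × ℝ) × (ℕ → Plane)) × ({l // l ≠ k} → ℝ × ℂ) → ℝ≥0∞ := fun x =>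
    linkFactor α β σ2 R Fp₀ x.1.1 (x.1.2 k + offset x.1.1) *
      nexp (ENNReal.ofReal β * markZ α x.1.1 * ∑' l : {l // l ≠ k}, rxPower α (x.2 l).1 (x.2 l).2
        (dist (x.1.2 l) (x.1.2 k + offset x.1.1))) with hF
  have hFm : Measurable F := by
    refine Measurable.mul ?_ (measurable_nexp.comp (Measurable.mul (by fun_prop)
      (Measurable.tsum fun l => ?_)))
    · exact hlf.comp (f := fun x : ((ℝ × ℝ × ℝ) × (ℕ → Plane)) × ({l // l ≠ k} → ℝ × ℂ) =>
        (x.1.1, x.1.2 k + offset x.1.1)) (by fun_prop)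
    · exact measurable_rxPower (by fun_prop) (by fun_prop) (by fun_prop)
  have h1 := hN.lintegral_comp_prodMk T hX hY hFm
  refine h1.trans (lintegral_congr fun ω => ?_)
  have hm2 : Measurable fun w : {l // l ≠ k} → ℝ × ℂ =>
      nexp (ENNReal.ofReal β * markZ α (N.mark k ω) * ∑' l : {l // l ≠ k},
        rxPower α (w l).1 (w l).2 (dist (N.tx l ω) (N.rx k ω))) :=
    measurable_nexp.comp ((Measurable.tsum fun l =>
      measurable_rxPower (by fun_prop) (by fun_prop) (by fun_prop)).const_mul _)
  simp only [hF, ← rx_eq]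
  rw [lintegral_const_mul _ hm2, lintegral_map hm2 (hY.mono (hN.sources_le _) le_rfl)]
  by_cases hz : markZ α (N.mark k ω) = ∞
  · simp [linkFactor, hz]
  · congr 1
    exact hN.lintegral_nexp_tsum_rxPower α k (ENNReal.mul_ne_top ENNReal.ofReal_ne_top hz)
      fun l => dist (N.tx l ω) (N.rx k ω)

/-- The marks of a link are independent of the transmitter locations. -/
lemma lintegral_mark_tx (hN : N.IsModel P lam R Fp Fp₀ Fd) (k : ℕ)
    {F : (ℝ × ℝ × ℝ) × (ℕ → Plane) → ℝ≥0∞} (hF : Measurable F) :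
    ∫⁻ ω, F (N.mark k ω, fun i => N.tx i ω) ∂P =
      ∫⁻ m, ∫⁻ ω, F (m, fun i => N.tx i ω) ∂P ∂(markLaw Fp Fd) := by
  have htx : Measurable fun ω i => N.tx i ω := measurable_pi_lambda _ hN.measurable_tx
  have hp := Measure.isProbabilityMeasure_map (μ := P) htx.aemeasurable
  have h1 := hN.lintegral_comp_prodMk {Source.tx}
    (N.sources_mark (k := k) (by simp) (by simp) (by simp)) (N.sources_tx (by simp)) hF
  rw [h1, ← lintegral_map (f := fun m => ∫⁻ y, F (m, y) ∂(P.map fun ω i => N.tx i ω))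
    hF.lintegral_prod_right' (hN.measurable_mark k), hN.map_mark]
  exact lintegral_congr fun m => lintegral_map (hF.comp (by fun_prop)) htx

/-- Campbell's formula for receivers and their marks. -/
lemma tsum_lintegral_mark_rx (hN : N.IsModel P lam R Fp Fp₀ Fd)
    {F : (ℝ × ℝ × ℝ) × Plane → ℝ≥0∞} (hF : Measurable F) :
    ∑' k, ∫⁻ ω, F (N.mark k ω, N.rx k ω) ∂P =
      ENNReal.ofReal lam * ∫⁻ m, (∫⁻ y, F (m, y)) ∂(markLaw Fp Fd) := by
  have h1 : ∀ k, ∫⁻ ω, F (N.mark k ω, N.rx k ω) ∂P =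
      ∫⁻ m, ∫⁻ ω, F (m, N.tx k ω + offset m) ∂P ∂(markLaw Fp Fd) := fun k =>
    hN.lintegral_mark_tx k (F := fun x => F (x.1, x.2 k + offset x.1)) (hF.comp (by fun_prop))
  simp_rw [h1]
  have hm : ∀ k, Measurable fun m => ∫⁻ ω, F (m, N.tx k ω + offset m) ∂P := by
    intro k
    have := hN.measurable_tx k
    exact Measurable.lintegral_prod_right'
      (f := fun x : (ℝ × ℝ × ℝ) × Ω => F (x.1, N.tx k x.2 + offset x.1)) (hF.comp (by fun_prop))
  rw [← MeasureTheory.lintegral_tsum fun k => (hm k).aemeasurable,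
    ← lintegral_const_mul _ hF.lintegral_prod_right']
  refine lintegral_congr fun m => ?_
  rw [hN.poisson.lintegral_tsum (f := fun x => F (m, x + offset m)) (hF.comp (by fun_prop)),
    lintegral_add_right_eq_self (fun y => F (m, y))]

end IsModel
end Network

namespace Network

/-- The Laplace transform at `s` of the uplink interference at a uniform point of the cell. -/
def meanUplinkFactor (α R : ℝ) (Fp₀ : Measure ℝ) (s : ℝ≥0∞) : ℝ≥0∞ :=
  (volume (Metric.closedBall (0 : Plane) R))⁻¹ *
    ∫⁻ y in Metric.closedBall (0 : Plane) R, uplinkFactor α R Fp₀ s y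

/-- The conditional coverage probability of the typical link, given that its `Z` is `z`. -/
def coverageFactor (lam R α σ2 β : ℝ) (Fp Fp₀ : Measure ℝ) (z : ℝ≥0∞) : ℝ≥0∞ :=
  noiseFactor β σ2 z * meanUplinkFactor α R Fp₀ (ENNReal.ofReal β * z) *
    nexp (ENNReal.ofReal lam * ENNReal.ofReal (Real.pi / nsinc (2 / α) *
      (∫ y, y ^ (2 / α) ∂Fp) * (ENNReal.ofReal β * z).toReal ^ (2 / α)))

section

variable {R : ℝ}

lemma volume_cell_ne_zero (hR : 0 < R) : volume (Metric.closedBall (0 : Plane) R) ≠ 0 :=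
  (Metric.measure_closedBall_pos _ _ hR).ne'

lemma volume_cell_ne_top : volume (Metric.closedBall (0 : Plane) R) ≠ ∞ :=
  measure_closedBall_lt_top.ne

lemma lintegral_indicator_cell_mul (f : Plane → ℝ≥0∞) :
    ∫⁻ y, (Metric.closedBall (0 : Plane) R).indicator 1 y * f y =
      ∫⁻ y in Metric.closedBall (0 : Plane) R, f y := by
  rw [← lintegral_indicator Metric.isClosed_closedBall.measurableSet]
  refine lintegral_congr fun y => ?_
  by_cases h : y ∈ Metric.closedBall (0 : Plane) R
  · rw [Set.indicator_of_mem h, Set.indicator_of_mem h, Pi.one_apply, one_mul]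
  · rw [Set.indicator_of_notMem h, Set.indicator_of_notMem h, zero_mul]

lemma isProbabilityMeasure_uplinkLaw (hR : 0 < R) {Fp₀ : Measure ℝ} [IsProbabilityMeasure Fp₀] :
    IsProbabilityMeasure (uplinkLaw R Fp₀) := by
  have := cond_isProbabilityMeasure_of_finite (volume_cell_ne_zero hR) volume_cell_ne_top
  unfold uplinkLaw
  infer_instance

lemma uplinkFactor_le_one (hR : 0 < R) (α : ℝ) {Fp₀ : Measure ℝ} [IsProbabilityMeasure Fp₀]
    (s : ℝ≥0∞) (y : Plane) : uplinkFactor α R Fp₀ s y ≤ 1 := by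
  have := isProbabilityMeasure_uplinkLaw hR (Fp₀ := Fp₀)
  exact (lintegral_mono fun _ => nexp_le_one _).trans (by simp)

lemma meanUplinkFactor_le_one (hR : 0 < R) (α : ℝ) {Fp₀ : Measure ℝ} [IsProbabilityMeasure Fp₀]
    (s : ℝ≥0∞) : meanUplinkFactor α R Fp₀ s ≤ 1 := by
  have h : ∫⁻ y in Metric.closedBall (0 : Plane) R, uplinkFactor α R Fp₀ s y ≤
      volume (Metric.closedBall (0 : Plane) R) :=
    (lintegral_mono fun y => uplinkFactor_le_one hR α s y).trans (setLIntegral_one _).le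
  exact (mul_le_mul_right h _).trans
    (ENNReal.inv_mul_cancel (volume_cell_ne_zero hR) volume_cell_ne_top).le

lemma measurable_meanUplinkFactor (α : ℝ) (Fp₀ : Measure ℝ) [SFinite Fp₀] :
    Measurable (meanUplinkFactor α R Fp₀) := by
  unfold meanUplinkFactor
  exact (Measurable.lintegral_prod_right' (measurable_uplinkFactor α R Fp₀)).const_mul _

lemma measurable_coverageFactor (lam α σ2 β : ℝ) (Fp Fp₀ : Measure ℝ) [SFinite Fp₀] :
    Measurable (coverageFactor lam R α σ2 β Fp Fp₀) := by
  unfold coverageFactor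
  refine Measurable.mul (Measurable.mul (by fun_prop) ?_) (by fun_prop)
  exact (measurable_meanUplinkFactor α Fp₀).comp (by fun_prop)

lemma coverageFactor_ne_top (hR : 0 < R) (lam α σ2 β : ℝ) (Fp Fp₀ : Measure ℝ)
    [IsProbabilityMeasure Fp₀] (z : ℝ≥0∞) : coverageFactor lam R α σ2 β Fp Fp₀ z ≠ ∞ := by
  refine ENNReal.mul_ne_top (ENNReal.mul_ne_top ?_ (ne_top_of_le_ne_top ENNReal.one_ne_top
    (meanUplinkFactor_le_one hR α _))) (nexp_ne_top _)
  rcases eq_or_ne z ∞ with rfl | hz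
  · simp
  · rw [noiseFactor_of_ne_top hz]; exact nexp_ne_top _

lemma lintegral_exp_neg_rxPower_eq_uplinkFactor (α : ℝ) {s : ℝ} (hs : 0 ≤ s) (Fp₀ : Measure ℝ)
    [IsProbabilityMeasure Fp₀] (y : Plane) :
    ∫⁻ q, ENNReal.ofReal (Real.exp (-s * (rxPower α q.2.1 q.2.2 (dist q.1 y)).toReal))
        ∂(uplinkLaw R Fp₀) = uplinkFactor α R Fp₀ (ENNReal.ofReal s) y := by
  have h1 : ∀ᵐ u ∂(ProbabilityTheory.cond volume (Metric.closedBall (0 : Plane) R)), u ≠ y :=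
    cond_absolutelyContinuous.ae_le (Measure.ae_ne _ _)
  have h2 : ∀ᵐ q ∂(uplinkLaw R Fp₀), q.1 ≠ y := Measure.quasiMeasurePreserving_fst.ae h1
  refine lintegral_congr_ae ?_
  filter_upwards [h2] with q hq
  have hfin : rxPower α q.2.1 q.2.2 (dist q.1 y) ≠ ∞ := by
    refine ENNReal.mul_ne_top (by finiteness) ?_
    rw [ENNReal.ofReal_rpow_of_pos (dist_pos.2 hq)]
    exact ENNReal.ofReal_ne_top
  rw [nexp_of_ne_top (ENNReal.mul_ne_top ENNReal.ofReal_ne_top hfin), ENNReal.toReal_mul,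
    ENNReal.toReal_ofReal hs, neg_mul]

end

/-- The conditional coverage probability of link `k` with receiver in the cell, given its marks and
all the transmitter locations. -/
def linkCoverage (α β σ2 R : ℝ) (Fp Fp₀ : Measure ℝ) (k : ℕ)
    (x : (ℝ × ℝ × ℝ) × (ℕ → Plane)) : ℝ≥0∞ :=
  linkFactor α β σ2 R Fp₀ x.1 (x.2 k + offset x.1) *
    nexp (∑' l : {l // l ≠ k}, nlog (interferenceFactor α Fp (ENNReal.ofReal β * markZ α x.1)
      (dist (x.2 l) (x.2 k + offset x.1))))

lemma measurable_linkCoverage (α β σ2 R : ℝ) (Fp Fp₀ : Measure ℝ) [IsProbabilityMeasure Fp]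
    [SFinite Fp₀] (k : ℕ) : Measurable (linkCoverage α β σ2 R Fp Fp₀ k) := by
  have hIF := measurable_interferenceFactor (α := α) (Fp := Fp)
  have hlf := measurable_linkFactor α β σ2 R Fp₀
  refine Measurable.mul ?_ (measurable_nexp.comp (Measurable.tsum fun l =>
    measurable_nlog.comp ?_))
  · exact hlf.comp (f := fun x : (ℝ × ℝ × ℝ) × (ℕ → Plane) => (x.1, x.2 k + offset x.1))
      (by fun_prop)
  · exact hIF.comp (f := fun x : (ℝ × ℝ × ℝ) × (ℕ → Plane) =>
      (ENNReal.ofReal β * markZ α x.1, dist (x.2 l) (x.2 k + offset x.1))) (by fun_prop)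

namespace IsModel

variable {Ω : Type*} [MeasurableSpace Ω] {N : Network Ω} {P : Measure Ω} {lam R : ℝ}
  {Fp Fp₀ Fd : Measure ℝ}

lemma lintegral_typicalLink (hN : N.IsModel P lam R Fp Fp₀ Fd) {F : ℕ × Ω → ℝ≥0∞}
    (hF : Measurable F) :
    ∫⁻ x, F x ∂(N.typicalLink P lam R) =
      (ENNReal.ofReal lam * volume (Metric.closedBall (0 : Plane) R))⁻¹ *
        ∑' k, ∫⁻ ω, (Metric.closedBall (0 : Plane) R).indicator 1 (N.rx k ω) * F (k, ω) ∂P := by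
  rw [typicalLink, lintegral_smul_measure, lintegral_sum_measure, smul_eq_mul]
  congr 1
  refine tsum_congr fun k => ?_
  have hC : MeasurableSet {ω | N.rx k ω ∈ Metric.closedBall (0 : Plane) R} :=
    hN.measurable_rx k Metric.isClosed_closedBall.measurableSet
  rw [lintegral_map hF measurable_prodMk_left, ← lintegral_indicator hC]
  refine lintegral_congr fun ω => ?_
  by_cases h : N.rx k ω ∈ Metric.closedBall (0 : Plane) R
  · rw [Set.indicator_of_mem h, Set.indicator_of_mem (by exact h), Pi.one_apply, one_mul]
  · rw [Set.indicator_of_notMem h, Set.indicator_of_notMem (by exact h), zero_mul]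

lemma measurable_Z (hN : N.IsModel P lam R Fp Fp₀ Fd) (α : ℝ) :
    Measurable fun x : ℕ × Ω => N.Z α x.1 x.2 :=
  measurable_from_prod_countable_right fun k => Network.measurable_Z α (hN.measurable_mark k)

variable [IsProbabilityMeasure P]

lemma isProbabilityMeasure_markLaw (hN : N.IsModel P lam R Fp Fp₀ Fd) :
    IsProbabilityMeasure (markLaw Fp Fd) :=
  hN.map_mark 0 ▸ Measure.isProbabilityMeasure_map (hN.measurable_mark 0).aemeasurable

/-- The marks of the typical link have the law of the marks of a given link. -/
lemma lintegral_typicalLink_mark (hN : N.IsModel P lam R Fp Fp₀ Fd) (hlam : 0 < lam) (hR : 0 < R)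
    {F : ℝ × ℝ × ℝ → ℝ≥0∞} (hF : Measurable F) :
    ∫⁻ x, F (N.mark x.1 x.2) ∂(N.typicalLink P lam R) = ∫⁻ m, F m ∂(markLaw Fp Fd) := by
  have hm : Measurable fun x : ℕ × Ω => N.mark x.1 x.2 :=
    measurable_from_prod_countable_right hN.measurable_mark
  have h1 := hN.tsum_lintegral_mark_rx
    (F := fun x => (Metric.closedBall (0 : Plane) R).indicator 1 x.2 * F x.1)
    (((measurable_indicator_closedBall R).comp measurable_snd).mul (hF.comp measurable_fst))
  rw [hN.lintegral_typicalLink (F := fun x => F (N.mark x.1 x.2)) (hF.comp hm)]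
  simp only at h1 ⊢
  rw [h1]
  simp_rw [lintegral_indicator_cell_mul, setLIntegral_const]
  rw [lintegral_mul_const _ hF, mul_comm (∫⁻ m, F m ∂_), ← mul_assoc, ← mul_assoc,
    mul_assoc _ (ENNReal.ofReal lam), ENNReal.inv_mul_cancel, one_mul]
  · exact mul_ne_zero (by simpa using hlam) (volume_cell_ne_zero hR)
  · exact ENNReal.mul_ne_top ENNReal.ofReal_ne_top volume_cell_ne_top

lemma isProbabilityMeasure_typicalLink (hN : N.IsModel P lam R Fp Fp₀ Fd) (hlam : 0 < lam)
    (hR : 0 < R) : IsProbabilityMeasure (N.typicalLink P lam R) := by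
  have := hN.isProbabilityMeasure_markLaw
  constructor
  rw [← lintegral_one, hN.lintegral_typicalLink_mark hlam hR (F := fun _ => 1) measurable_const]
  simp

lemma laplaceY_eq (hN : N.IsModel P lam R Fp Fp₀ Fd) (hlam : 0 < lam)
    {α s : ℝ} (hs : 0 ≤ s) :
    N.laplaceY P lam R α s = (meanUplinkFactor α R Fp₀ (ENNReal.ofReal s)).toReal := by
  have := hN.isProbabilityMeasure_Fp₀
  have := hN.isProbabilityMeasure_markLaw
  have hY : Measurable fun x : ℕ × Ω => N.cellInterference α x.1 x.2 :=
    measurable_from_prod_countable_right (hN.measurable_cellInterference α)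
  have hE : Measurable fun x : ℕ × Ω =>
      Real.exp (-s * (N.cellInterference α x.1 x.2).toReal) := by fun_prop
  rw [laplaceY, integral_eq_lintegral_of_nonneg_ae (Eventually.of_forall fun x => Real.exp_nonneg _)
    hE.aestronglyMeasurable, hN.lintegral_typicalLink hE.ennreal_ofReal]
  congr 1
  have h1 : ∀ k, ∫⁻ ω, (Metric.closedBall (0 : Plane) R).indicator 1 (N.rx k ω) *
      ENNReal.ofReal (Real.exp (-s * (N.cellInterference α k ω).toReal)) ∂P =
      ∫⁻ ω, (Metric.closedBall (0 : Plane) R).indicator 1 (N.rx k ω) *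
        uplinkFactor α R Fp₀ (ENNReal.ofReal s) (N.rx k ω) ∂P := by
    intro k
    set T : Set Source := {Source.ue, Source.p₀, Source.h₀ k} with hT
    have hrx : Measurable[N.sources Tᶜ] (N.rx k) :=
      Network.measurable_rx (N.sources_tx_apply (by simp [hT]) k)
        (N.sources_mark (by simp [hT]) (by simp [hT]) (by simp [hT]))
    have hFm : Measurable fun x : Plane × Plane × ℝ × ℂ =>
        (Metric.closedBall (0 : Plane) R).indicator 1 x.1 * ENNReal.ofReal
          (Real.exp (-s * (rxPower α x.2.2.1 x.2.2.2 (dist x.2.1 x.1)).toReal)) :=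
      ((measurable_indicator_closedBall R).comp measurable_fst).mul (by fun_prop)
    have h2 := hN.lintegral_comp_prodMk T hrx
      ((N.sources_ue (by simp [hT])).prodMk ((N.sources_p₀ (by simp [hT])).prodMk
        (N.sources_h₀ (k := k) (by simp [hT])))) hFm
    rw [hN.map_uplink] at h2
    refine h2.trans (lintegral_congr fun ω => ?_)
    simp only
    rw [lintegral_const_mul _ (by fun_prop), lintegral_exp_neg_rxPower_eq_uplinkFactor α hs]
  have hu := (measurable_uplinkFactor α R Fp₀).comp
    (measurable_prodMk_left (x := ENNReal.ofReal s))
  have h3 := hN.tsum_lintegral_mark_rx (F := fun x : (ℝ × ℝ × ℝ) × Plane =>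
    (Metric.closedBall (0 : Plane) R).indicator 1 x.2 *
      uplinkFactor α R Fp₀ (ENNReal.ofReal s) x.2)
    (((measurable_indicator_closedBall R).comp measurable_snd).mul (hu.comp measurable_snd))
  simp_rw [h1]
  simp only [lintegral_indicator_cell_mul, lintegral_const, measure_univ, mul_one] at h3
  rw [h3, meanUplinkFactor, ← mul_assoc,
    ENNReal.mul_inv (Or.inr volume_cell_ne_top) (Or.inl ENNReal.ofReal_ne_top),
    mul_right_comm (ENNReal.ofReal lam)⁻¹, ENNReal.inv_mul_cancel (by simpa using hlam) ENNReal.ofReal_ne_top, one_mul]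

/-- The expected number of covered receivers in the cell, if all the links had marks `m`. -/
lemma lintegral_tsum_linkCoverage (hN : N.IsModel P lam R Fp Fp₀ Fd) (hlam : 0 < lam) (hR : 0 < R)
    {α σ2 β : ℝ} (hα : 2 < α) (hFp : ∀ᵐ x ∂Fp, 0 ≤ x)
    (hmom : Integrable (fun x : ℝ => x ^ (2 / α)) Fp) (m : ℝ × ℝ × ℝ) :
    (ENNReal.ofReal lam * volume (Metric.closedBall (0 : Plane) R))⁻¹ *
        ∫⁻ ω, ∑' k, linkCoverage α β σ2 R Fp Fp₀ k (m, fun i => N.tx i ω) ∂P =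
      coverageFactor lam R α σ2 β Fp Fp₀ (markZ α m) := by
  have := hN.isProbabilityMeasure_Fp₀
  have := hN.isProbabilityMeasure_Fp
  have hα0 : 0 < α := by linarith
  unfold linkCoverage
  simp only
  by_cases hz : markZ α m = ∞
  · simp [linkFactor, coverageFactor, hz]
  have hs : ENNReal.ofReal β * markZ α m ≠ ∞ := ENNReal.mul_ne_top ENNReal.ofReal_ne_top hz
  have hnexp : ∀ r, nexp (nlog (interferenceFactor α Fp (ENNReal.ofReal β * markZ α m) r)) =
      interferenceFactor α Fp (ENNReal.ofReal β * markZ α m) r :=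
    fun r => nexp_nlog (interferenceFactor_le_one _ _)
  have hφ : ∫⁻ y, linkFactor α β σ2 R Fp₀ m y = noiseFactor β σ2 (markZ α m) *
      ∫⁻ y in Metric.closedBall (0 : Plane) R,
        uplinkFactor α R Fp₀ (ENNReal.ofReal β * markZ α m) y := by
    unfold linkFactor
    rw [lintegral_indicator_cell_mul, lintegral_const_mul' _ _ (by
      rw [noiseFactor_of_ne_top hz]; exact nexp_ne_top _)]
  have hint : ∫⁻ y in Metric.closedBall (0 : Plane) R,
      uplinkFactor α R Fp₀ (ENNReal.ofReal β * markZ α m) y ≠ ∞ :=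
    ne_top_of_le_ne_top volume_cell_ne_top
      ((lintegral_mono fun y => uplinkFactor_le_one hR α _ y).trans (setLIntegral_one _).le)
  have hφ' : ∫⁻ y, linkFactor α β σ2 R Fp₀ m y ≠ ∞ := by
    rw [hφ, noiseFactor_of_ne_top hz]
    exact ENNReal.mul_ne_top (nexp_ne_top _) hint
  have hφm : Measurable (linkFactor α β σ2 R Fp₀ m) :=
    Measurable.of_uncurry_left (f := linkFactor α β σ2 R Fp₀) (measurable_linkFactor α β σ2 R Fp₀)
  have hga : Antitone fun r =>
      nlog (interferenceFactor α Fp (ENNReal.ofReal β * markZ α m) r) :=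
    antitone_nlog.comp_monotone (monotone_interferenceFactor hα0.le _)
  have hgc : Continuous fun r =>
      nexp (nlog (interferenceFactor α Fp (ENNReal.ofReal β * markZ α m) r)) := by
    simp only [hnexp]
    exact continuous_interferenceFactor hs
  have hgf : ∫⁻ u : Plane, (1 - nexp (nlog (interferenceFactor α Fp
      (ENNReal.ofReal β * markZ α m) (‖u‖ - 1)))) ≠ ∞ := by
    simp only [hnexp]
    exact lintegral_one_sub_interferenceFactor_sub_one_ne_top hα hFp hmom hs
  rw [hN.poisson.lintegral_tsum_mul_nexp_tsum_dist hφm hφ' hga hgc hgf (offset m)]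
  simp only [hnexp]
  rw [lintegral_one_sub_interferenceFactor hα hFp hmom hs, hφ, coverageFactor,
    meanUplinkFactor, ← mul_assoc, ← mul_assoc,
    ENNReal.mul_inv (Or.inr volume_cell_ne_top) (Or.inl ENNReal.ofReal_ne_top),
    mul_right_comm (ENNReal.ofReal lam)⁻¹, ENNReal.inv_mul_cancel (by simpa using hlam)
      ENNReal.ofReal_ne_top, one_mul]
  ring

lemma lintegral_indicator_le_sinr (hN : N.IsModel P lam R Fp Fp₀ Fd) {α σ2 β : ℝ} (hα : 0 < α)
    (hβ : 0 < β) (hFp : ∀ᵐ x ∂Fp, 0 ≤ x) (hFd : ∀ᵐ x ∂Fd, 0 < x) (k : ℕ) :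
    ∫⁻ ω, (Metric.closedBall (0 : Plane) R).indicator 1 (N.rx k ω) *
        {x | ENNReal.ofReal β ≤ x}.indicator 1 (N.sinr α σ2 k ω) ∂P =
      ∫⁻ m, ∫⁻ ω, linkCoverage α β σ2 R Fp Fp₀ k (m, fun i => N.tx i ω) ∂P ∂(markLaw Fp Fd) := by
  have := hN.isProbabilityMeasure_Fp₀
  have := hN.isProbabilityMeasure_Fp
  rw [← hN.lintegral_mark_tx k (measurable_linkCoverage α β σ2 R Fp Fp₀ k),
    hN.measure_le_sinr_eq_lintegral hα hβ hFp hFd k, hN.lintegral_uplink k, hN.lintegral_d2d k]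
  simp only [linkCoverage, rx_eq, Z_eq]

/-- The coverage probability of the typical link as an integral over its marks. -/
lemma typicalLink_le_sinr (hN : N.IsModel P lam R Fp Fp₀ Fd) (hlam : 0 < lam) (hR : 0 < R)
    {α σ2 β : ℝ} (hα : 2 < α) (hβ : 0 < β) (hFp : ∀ᵐ x ∂Fp, 0 ≤ x) (hFd : ∀ᵐ x ∂Fd, 0 < x)
    (hmom : Integrable (fun x : ℝ => x ^ (2 / α)) Fp) :
    N.typicalLink P lam R {x | ENNReal.ofReal β ≤ N.sinr α σ2 x.1 x.2} =
      ∫⁻ m, coverageFactor lam R α σ2 β Fp Fp₀ (markZ α m) ∂(markLaw Fp Fd) := by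
  have := hN.isProbabilityMeasure_Fp₀
  have := hN.isProbabilityMeasure_Fp
  have hS : Measurable fun x : ℕ × Ω => N.sinr α σ2 x.1 x.2 :=
    measurable_from_prod_countable_right (hN.measurable_sinr α σ2)
  have hI : Measurable ({x : ℝ≥0∞ | ENNReal.ofReal β ≤ x}.indicator (1 : ℝ≥0∞ → ℝ≥0∞)) :=
    measurable_one.indicator measurableSet_Ici
  have hset : MeasurableSet {x : ℕ × Ω | ENNReal.ofReal β ≤ N.sinr α σ2 x.1 x.2} :=
    measurableSet_le measurable_const hS
  have h0 : ∀ x : ℕ × Ω, {x : ℕ × Ω | ENNReal.ofReal β ≤ N.sinr α σ2 x.1 x.2}.indicator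
      (1 : ℕ × Ω → ℝ≥0∞) x = {x | ENNReal.ofReal β ≤ x}.indicator 1 (N.sinr α σ2 x.1 x.2) :=
    fun x => rfl
  have hm := measurable_linkCoverage α β σ2 R Fp Fp₀
  have htx : Measurable fun ω i => N.tx i ω := measurable_pi_lambda _ hN.measurable_tx
  have h2 : ∀ k, Measurable fun m =>
      ∫⁻ ω, linkCoverage α β σ2 R Fp Fp₀ k (m, fun i => N.tx i ω) ∂P := fun k =>
    Measurable.lintegral_prod_right' (f := fun x : (ℝ × ℝ × ℝ) × Ω =>
      linkCoverage α β σ2 R Fp Fp₀ k (x.1, fun i => N.tx i x.2))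
      ((hm k).comp (measurable_fst.prodMk (htx.comp measurable_snd)))
  have h3 : ∀ m k, AEMeasurable (fun ω =>
      linkCoverage α β σ2 R Fp Fp₀ k (m, fun i => N.tx i ω)) P := fun m k =>
    ((hm k).comp (measurable_prodMk_left.comp htx)).aemeasurable
  rw [← lintegral_indicator_one hset, lintegral_congr h0,
    hN.lintegral_typicalLink (F := fun x => {x | ENNReal.ofReal β ≤ x}.indicator 1
      (N.sinr α σ2 x.1 x.2)) (hI.comp hS)]
  simp only
  rw [tsum_congr fun k => hN.lintegral_indicator_le_sinr (by linarith) hβ hFp hFd k,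
    ← MeasureTheory.lintegral_tsum fun k => (h2 k).aemeasurable,
    ← lintegral_const_mul' _ _ (ENNReal.inv_ne_top.2
      (mul_ne_zero (by simpa using hlam) (volume_cell_ne_zero hR)))]
  refine lintegral_congr fun m => ?_
  rw [← MeasureTheory.lintegral_tsum (h3 m), hN.lintegral_tsum_linkCoverage hlam hR hα hFp hmom]

/-- The conditional coverage probability is the coverage kernel. -/
lemma coverageKernel_eq (hN : N.IsModel P lam R Fp Fp₀ Fd) (hlam : 0 < lam)
    {α σ2 β : ℝ} (hα : 2 < α) (hσ2 : 0 ≤ σ2) (hβ : 0 < β) (hFp : ∀ᵐ x ∂Fp, 0 ≤ x) (z : ℝ≥0∞) :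
    coverageKernel α β (σ2 * β)
      (Real.pi * lam * β ^ (2 / α) / nsinc (2 / α) * ∫ y, y ^ (2 / α) ∂Fp)
      (N.laplaceY P lam R α) z = (coverageFactor lam R α σ2 β Fp Fp₀ z).toReal := by
  rw [coverageKernel, coverageFactor]
  rcases eq_or_ne z ∞ with rfl | hz
  · simp
  have hα0 : 0 < α := by linarith
  have ha : 0 < 2 / α := by positivity
  have hns : 0 < nsinc (2 / α) := nsinc_pos ha ((div_lt_one hα0).2 hα)
  have hE : 0 ≤ ∫ y, y ^ (2 / α) ∂Fp :=
    integral_nonneg_of_ae (hFp.mono fun x hx => Real.rpow_nonneg hx _)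
  have hz0 : 0 ≤ z.toReal := ENNReal.toReal_nonneg
  have hs : (ENNReal.ofReal β * z).toReal = β * z.toReal := by
    rw [ENNReal.toReal_mul, ENNReal.toReal_ofReal hβ.le]
  have hs' : ENNReal.ofReal β * z = ENNReal.ofReal (β * z.toReal) := by
    rw [ENNReal.ofReal_mul hβ.le, ENNReal.ofReal_toReal hz]
  rw [if_neg hz, noiseFactor_of_ne_top hz, hs,
    hN.laplaceY_eq hlam (by positivity), hs', ← ENNReal.ofReal_mul (by positivity),
    nexp_ofReal (by positivity), ← ENNReal.ofReal_mul hlam.le, nexp_ofReal (by positivity),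
    ENNReal.toReal_mul, ENNReal.toReal_mul, ENNReal.toReal_ofReal (Real.exp_nonneg _),
    ENNReal.toReal_ofReal (Real.exp_nonneg _), mul_right_comm (Real.exp (-(β * z.toReal * σ2))),
    ← Real.exp_add,
    Real.mul_rpow hβ.le hz0]
  congr 2
  ring

/-- The distribution function of `Z`, given the power. -/
lemma measure_markZ_le {α z : ℝ} (hα : 0 < α) (hz : 0 ≤ z) [IsProbabilityMeasure Fd]
    (hFd : ∀ᵐ x ∂Fd, 0 < x) (θ : ℝ) {p : ℝ} (hp : 0 ≤ p) :
    Fd {d | markZ α (d, θ, p) ≤ ENNReal.ofReal z} =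
      ENNReal.ofReal (cdf Fd (z ^ (1 / α) * p ^ (1 / α))) := by
  rw [ofReal_cdf]
  refine measure_congr ?_
  filter_upwards [hFd] with d hd
  refine propext ?_
  change markZ α (d, θ, p) ≤ ENNReal.ofReal z ↔ d ≤ z ^ (1 / α) * p ^ (1 / α)
  rw [markZ]
  simp only
  have hdα : 0 < d ^ α := Real.rpow_pos_of_pos hd _
  rw [ENNReal.ofReal_rpow_of_pos hd]
  rcases hp.eq_or_lt with rfl | hp
  · rw [Real.zero_rpow (by positivity), mul_zero, ENNReal.ofReal_zero, ENNReal.inv_zero,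
      ENNReal.top_mul (by simpa using hdα)]
    simp [hd]
  · rw [← ENNReal.ofReal_inv_of_pos hp, ← ENNReal.ofReal_mul (by positivity),
      ENNReal.ofReal_le_ofReal_iff hz, ← Real.mul_rpow hz hp.le, one_div,
      Real.le_rpow_inv_iff_of_pos hd.le (by positivity) hα, inv_mul_le_iff₀ hp, mul_comm p]

lemma markLaw_markZ_le (hN : N.IsModel P lam R Fp Fp₀ Fd) {α z : ℝ} (hα : 0 < α) (hz : 0 ≤ z)
    (hFp : ∀ᵐ x ∂Fp, 0 ≤ x) (hFd : ∀ᵐ x ∂Fd, 0 < x) :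
    (markLaw Fp Fd).real {m | markZ α m ≤ ENNReal.ofReal z} =
      ∫ y, cdf Fd (z ^ (1 / α) * y ^ (1 / α)) ∂Fp := by
  have := hN.isProbabilityMeasure_Fp
  have := hN.isProbabilityMeasure_Fd
  have : IsProbabilityMeasure (ProbabilityTheory.cond (volume : Measure ℝ)
      (Set.Ico 0 (2 * Real.pi))) :=
    cond_isProbabilityMeasure_of_finite (by simp [Real.pi_pos]) measure_Ico_lt_top.ne
  have hS : MeasurableSet {m | markZ α m ≤ ENNReal.ofReal z} :=
    measurableSet_le (measurable_markZ α) measurable_const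
  have hcm : Measurable fun y : ℝ => cdf Fd (z ^ (1 / α) * y ^ (1 / α)) :=
    (cdf Fd).mono.measurable.comp (by fun_prop)
  rw [integral_eq_lintegral_of_nonneg_ae (Eventually.of_forall fun y => cdf_nonneg _ _)
    hcm.aestronglyMeasurable, measureReal_def, markLaw, Measure.prod_apply_symm hS]
  congr 1
  have h1 : ∀ᵐ x ∂((ProbabilityTheory.cond (volume : Measure ℝ)
      (Set.Ico 0 (2 * Real.pi))).prod Fp),
      Fd ((fun d => (d, x)) ⁻¹' {m | markZ α m ≤ ENNReal.ofReal z}) =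
        ENNReal.ofReal (cdf Fd (z ^ (1 / α) * x.2 ^ (1 / α))) := by
    filter_upwards [Measure.quasiMeasurePreserving_snd.ae hFp] with x hx
    exact measure_markZ_le hα hz hFd x.1 hx
  have hcm' : Measurable fun x : ℝ × ℝ =>
      ENNReal.ofReal (cdf Fd (z ^ (1 / α) * x.2 ^ (1 / α))) :=
    (hcm.comp measurable_snd).ennreal_ofReal
  rw [lintegral_congr_ae h1, lintegral_prod _ hcm'.aemeasurable]
  simp

end IsModel
end Network
end D2D
end

theorem theorem3 {Ω : Type*} [MeasurableSpace Ω] (P : Measure Ω) [IsProbabilityMeasure P]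
    (N : D2D.Network Ω) (lam R α σ2 β : ℝ) (Fp Fp₀ Fd : Measure ℝ)
    (hlam : 0 < lam) (hR : 0 < R) (hα : 2 < α) (hσ2 : 0 ≤ σ2) (hβ : 0 < β)
    (hN : N.IsModel P lam R Fp Fp₀ Fd)
    -- powers are nonnegative, link lengths are positive
    (hFp : ∀ᵐ x ∂Fp, 0 ≤ x) (hFp₀ : ∀ᵐ x ∂Fp₀, 0 ≤ x) (hFd : ∀ᵐ x ∂Fd, 0 < x)
    -- the moment `E[p_k^(2/α)]` is finite
    (hmom : Integrable (fun x : ℝ => x ^ (2 / α)) Fp) :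
    -- the law of the typical link is a probability law
    IsProbabilityMeasure (N.typicalLink P lam R) ∧
    -- the coverage probability
    N.coverage P lam R α σ2 β =
      ∫ x, D2D.coverageKernel α β (σ2 * β)
          (Real.pi * lam * β ^ (2 / α) / D2D.nsinc (2 / α) * ∫ y, y ^ (2 / α) ∂Fp)
          (N.laplaceY P lam R α) (N.Z α x.1 x.2) ∂(N.typicalLink P lam R) ∧
    -- the distribution function of `Z`
    (∀ z : ℝ, 0 ≤ z →
      (N.typicalLink P lam R).real {x | N.Z α x.1 x.2 ≤ ENNReal.ofReal z} =
        ∫ y, cdf Fd (z ^ (1 / α) * y ^ (1 / α)) ∂Fp) := by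
  have := hN.isProbabilityMeasure_Fp₀
  have hα0 : 0 < α := by linarith
  refine ⟨hN.isProbabilityMeasure_typicalLink hlam hR, ?_, fun z hz => ?_⟩
  · have hm := D2D.Network.measurable_coverageFactor (R := R) lam α σ2 β Fp Fp₀
    simp_rw [hN.coverageKernel_eq hlam hα hσ2 hβ hFp]
    have hmZ : AEMeasurable (fun x : ℕ × Ω => D2D.Network.coverageFactor lam R α σ2 β Fp Fp₀
        (N.Z α x.1 x.2)) (N.typicalLink P lam R) := (hm.comp (hN.measurable_Z α)).aemeasurable
    rw [integral_toReal hmZ (Filter.Eventually.of_forall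
      fun x => (D2D.Network.coverageFactor_ne_top hR lam α σ2 β Fp Fp₀ _).lt_top),
      D2D.Network.coverage, measureReal_def,
      hN.typicalLink_le_sinr hlam hR hα hβ hFp hFd hmom,
      ← hN.lintegral_typicalLink_mark hlam hR
        (F := fun m => D2D.Network.coverageFactor lam R α σ2 β Fp Fp₀ (D2D.markZ α m))
        (hm.comp (D2D.measurable_markZ α))]
    rfl
  · rw [← hN.markLaw_markZ_le hα0 hz hFp hFd, measureReal_def, measureReal_def]
    congr 1
    have hS : MeasurableSet {m | D2D.markZ α m ≤ ENNReal.ofReal z} :=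
      measurableSet_le (D2D.measurable_markZ α) measurable_const
    have hS' : MeasurableSet {x : ℕ × Ω | N.Z α x.1 x.2 ≤ ENNReal.ofReal z} :=
      measurableSet_le (hN.measurable_Z α) measurable_const
    rw [← lintegral_indicator_one hS, ← lintegral_indicator_one hS',
      ← hN.lintegral_typicalLink_mark hlam hR (measurable_one.indicator hS)]
    rfl
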